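/- Consider a finite Markov decision process with nonempty finite state set $\mathcal S$ and action set $\mathcal A$, transition matrices $P_a$ ($a\in\mathcal A$), reward function $\mathcal R:\mathcal S\times\mathcal A\to[0,1]$ and discount factor $\gamma\in(0,1)$. Let $\pi_b$ be a behavior policy with $\pi_b(a|s)>0$ for all $(s,a)$ such that the induced Markov chain on $\mathcal S$, with transition matrix $P(s,s')=\sum_a\pi_b(a|s)P_a(s,s')$, is irreducible and aperiodic. Let $n\ge 1$ be an integer and let $c,\rho:\mathcal S\times\mathcal A\to[0,\infty)$ satisfy $c(s,a)\le\rho(s,a)$ for all $(s,a)$. Write $D_c(s)=\sum_a\pi_b(a|s)c(s,a)$ and $D_\rho(s)=\sum_a\pi_b(a|s)\rho(s,a)$, let $D_{c,\min}=\min_s D_c(s)$, $D_{\rho,\max}=\max_s D_\rho(s)$, $c_{\max}=\max_{s,a} c(s,a)$, $\rho_{\max}=\max_{s,a}\rho(s,a)$, and assume $D_{\rho,\max}<1/\gamma$. Then $P$ has a unique stationary distribution $\kappa_S$, and the operator $$[\mathcal H_\rho(Q)](s,a)=\mathcal R(s,a)+\gamma\sum_{s'}P_a(s,s')\sum_{a'}\pi_b(a'|s')\rho(s',a')Q(s',a')$$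 has a unique fixed point $Q^{\pi,\rho}$. Put $f(x)=n$ if $x=1$ and $f(x)=\frac{1-x^n}{1-x}$ if $x\ne1$, $$\omega=\Big(\min_{s,a}\kappa_S(s)\pi_b(a|s)\Big)\,f(\gamma D_{c,\min})\,(1-\gamma D_{\rho,\max}),$$ and, for $\delta>0$, $\tau_{\delta,n}=t_\delta+n+1$, where $t_\delta=\min\{k\ge0:\max_s\|P^k(s,\cdot)-\kappa_S\|_{\mathrm{TV}}\le\delta\}$ and $\|p-q\|_{\mathrm{TV}}=\frac12\sum_s|p(s)-q(s)|$. Let $(S_k,A_k)_{k\ge0}$ be a trajectory of the process under $\pi_b$ (with arbitrary distribution of $S_0$), let $Q_0:\mathcal S\times\mathcal A\to\mathbb R$ be deterministic, let $\alpha>0$, and define $Q_k$ by $$Q_{k+1}(s,a)=Q_k(s,a)+\alpha\,\mathbb I_{\{(s,a)=(S_k,A_k)\}}\sum_{i=k}^{k+n-1}\gamma^{i-k}\Big(\prod_{j=k+1}^{i}c(S_j,A_j)\Big)\Delta_i(Q_k),$$ where $\Delta_i(Q)=\mathcal R(S_i,A_i)+\gamma\rho(S_{i+1},A_{i+1})Q(S_{i+1},A_{i+1})-Q(S_i,A_i)$.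 If $$\alpha\,\tau_{\alpha,n}\le\frac{c_1\,\omega}{\log(2|\mathcal S||\mathcal A|/\omega)\,f(\gamma c_{\max})^2(\gamma\rho_{\max}+1)^2},$$ then for all $k\ge\tau_{\alpha,n}$ $$\mathbb E\big[\|Q_k-Q^{\pi,\rho}\|_\infty^2\big]\le\zeta_1\Big(1-\frac{\omega\alpha}2\Big)^{k-\tau_{\alpha,n}}+\zeta_2\,\frac{f(\gamma c_{\max})^2(\gamma\rho_{\max}+1)^2\log(2|\mathcal S||\mathcal A|/\omega)}{\omega}\,\alpha\,\tau_{\alpha,n},$$ where $\zeta_1=c_2(\|Q_0-Q^{\pi,\rho}\|_\infty+\|Q_0\|_\infty+1)^2$, $\zeta_2=c_3(3\|Q^{\pi,\rho}\|_\infty+1)^2$, and $c_1=\frac1{32832}$, $c_2=2$, $c_3=912e$. -/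

import Mathlib

open MeasureTheory

noncomputable section

namespace OffPolicyTD

/-- A finite Markov decision process with states `S` and actions `A`: for every action `a` a
transition probability matrix `trans a`, a reward function with values in `[0,1]`, and a discount
factor in `(0,1)`. -/
structure FiniteMDP (S A : Type*) [Fintype S] [DecidableEq S] where
  trans : A → Matrix S S ℝ
  trans_stochastic : ∀ a, trans a ∈ Matrix.rowStochastic ℝ S
  reward : S × A → ℝ
  reward_mem : ∀ x, reward x ∈ Set.Icc (0 : ℝ) 1
  discount : ℝ
  discount_mem : discount ∈ Set.Ioo (0 : ℝ) 1

/-- A stationary randomized policy: `prob s a` is the probability of action `a` in state `s`. -/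
structure Policy (S A : Type*) [Fintype A] where
  prob : S → A → ℝ
  prob_mem : ∀ s, prob s ∈ stdSimplex ℝ A

section Chain

variable {S : Type*} [Fintype S] [DecidableEq S]

/-- A finite Markov chain is aperiodic if, for every state `s`, the greatest common divisor of the
return times `{k ≥ 1 | P ^ k (s, s) > 0}` is `1`. -/
def IsAperiodic (P : Matrix S S ℝ) : Prop :=
  ∀ s : S, ∀ d : ℕ, (∀ k : ℕ, 1 ≤ k → 0 < (P ^ k) s s → d ∣ k) → d = 1

/-- `κ` is a stationary (probability) distribution of the transition matrix `P`. -/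
def IsStationary (P : Matrix S S ℝ) (κ : S → ℝ) : Prop :=
  κ ∈ stdSimplex ℝ S ∧ Matrix.vecMul κ P = κ

/-- Total variation distance between two distributions on a finite set. -/
def tvDist (p q : S → ℝ) : ℝ := (1 / 2) * ∑ s, |p s - q s|

/-- The mixing time `t_δ`: the least `k` with `max_s ‖P ^ k (s, ·) - κ‖_TV ≤ δ`. -/
def mixingTime (P : Matrix S S ℝ) (κ : S → ℝ) (δ : ℝ) : ℕ :=
  sInf {k : ℕ | ∀ s, tvDist ((P ^ k) s) κ ≤ δ}

end Chain

/-- `f(x) = n` if `x = 1`, and `f(x) = (1 - x ^ n) / (1 - x)` otherwise. -/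
def geomFactor (n : ℕ) (x : ℝ) : ℝ :=
  open Classical in if x = 1 then (n : ℝ) else (1 - x ^ n) / (1 - x)

section MDP

variable {S A : Type*} [Fintype S] [DecidableEq S] [Fintype A] [DecidableEq A]

/-- Transition matrix of the state chain `(S_k)` induced by a policy. -/
def stateChain (M : FiniteMDP S A) (πb : Policy S A) : Matrix S S ℝ :=
  Matrix.of fun s s' => ∑ a, πb.prob s a * M.trans a s s'

/-- `X 0, X 1, …` with `X k = (S_k, A_k)` is a trajectory of the MDP under the policy `πb`, with an
arbitrary distribution of `S_0`: first `A_0 ∼ πb(· | S_0)`; and, conditionally on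
`X 0, …, X k`, the next state has law `P_{A_k}(S_k, ·)` and the next action has law
`πb(· | S_{k+1})`. -/
structure IsTrajectory {Ω : Type*} [MeasurableSpace Ω] (M : FiniteMDP S A) (πb : Policy S A)
    (μ : Measure Ω) (X : ℕ → Ω → S × A) : Prop where
  measurableSet_fiber : ∀ k x, MeasurableSet {w | X k w = x}
  init : ∀ s a, μ.real {w | X 0 w = (s, a)} = μ.real {w | (X 0 w).1 = s} * πb.prob s a
  step : ∀ (k : ℕ) (h : ℕ → S × A),
    μ.real {w | ∀ i ≤ k + 1, X i w = h i} =
      μ.real {w | ∀ i ≤ k, X i w = h i} *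
        (M.trans (h k).2 (h k).1 (h (k + 1)).1 * πb.prob (h (k + 1)).1 (h (k + 1)).2)

/-- The temporal difference
`Δ(s, a, s', a', Q) = R(s, a) + γ ρ(s', a') Q(s', a') - Q(s, a)`. -/
def tdError (M : FiniteMDP S A) (ρ : S × A → ℝ) (x x' : S × A) (Q : S × A → ℝ) : ℝ :=
  M.reward x + M.discount * ρ x' * Q x' - Q x

/-- The iterates `Q_k` of the generic `n`-step off-policy TD algorithm with generalized importance
sampling ratios `c`, `ρ` and stepsizes `α_k`, run along the sample path
`x k = (S_k, A_k)` from the initial point `Q₀`. -/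
def tdIterate (M : FiniteMDP S A) (n : ℕ) (c ρ : S × A → ℝ) (α : ℕ → ℝ) (Q₀ : S × A → ℝ)
    (x : ℕ → S × A) : ℕ → S × A → ℝ
  | 0 => Q₀
  | k + 1 => fun y =>
      tdIterate M n c ρ α Q₀ x k y +
        (if y = x k then α k else 0) *
          ∑ i ∈ Finset.Ico k (k + n),
            M.discount ^ (i - k) * (∏ j ∈ Finset.Icc (k + 1) i, c (x j)) *
              tdError M ρ (x i) (x (i + 1)) (tdIterate M n c ρ α Q₀ x k)

/-- The operator `H_ρ`:
`[H_ρ Q](s, a) = R(s, a) + γ E_{πb}[ρ(S₁, A₁) Q(S₁, A₁) | S₀ = s, A₀ = a]`. -/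
def bellmanOp (M : FiniteMDP S A) (πb : Policy S A) (ρ : S × A → ℝ) (Q : S × A → ℝ) :
    S × A → ℝ := fun x =>
  M.reward x + M.discount *
    ∑ s', M.trans x.2 x.1 s' * ∑ a', πb.prob s' a' * (ρ (s', a') * Q (s', a'))

/-- The diagonal entries `D_c(s) = ∑_a πb(a | s) c(s, a)`, which do not depend on the action. -/
def diagD (πb : Policy S A) (c : S × A → ℝ) (s : S) : ℝ := ∑ a, πb.prob s a * c (s, a)

/-- `𝒦_{SA,min} = min_{s,a} κ(s) πb(a | s)`. -/
def kappaMin (πb : Policy S A) (κ : S → ℝ) : ℝ := ⨅ x : S × A, κ x.1 * πb.prob x.1 x.2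

/-- `ω = 𝒦_{SA,min} f(γ D_{c,min}) (1 - γ D_{ρ,max})`. -/
def modulus (M : FiniteMDP S A) (πb : Policy S A) (n : ℕ) (c ρ : S × A → ℝ) (κ : S → ℝ) : ℝ :=
  kappaMin πb κ * geomFactor n (M.discount * ⨅ s, diagD πb c s) *
    (1 - M.discount * ⨆ s, diagD πb ρ s)

/-- `τ_{δ,n} = t_δ + n + 1`. -/
def lag (M : FiniteMDP S A) (πb : Policy S A) (n : ℕ) (κ : S → ℝ) (δ : ℝ) : ℕ :=
  mixingTime (stateChain M πb) κ δ + n + 1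

/-- The quantity `log(2|S||A|/ω) f(γ c_max)² (γ ρ_max + 1)²`. -/
def varianceFactor (M : FiniteMDP S A) (πb : Policy S A) (n : ℕ) (c ρ : S × A → ℝ)
    (κ : S → ℝ) : ℝ :=
  Real.log (2 * Fintype.card S * Fintype.card A / modulus M πb n c ρ κ) *
    geomFactor n (M.discount * ⨆ x, c x) ^ 2 * (M.discount * (⨆ x, ρ x) + 1) ^ 2

end MDP

end OffPolicyTD

end

/-! At stationarity the expected update is affine: it sends `Q` to `(M̄ - 1) (Q - Qs)`, where `M̄`
is `meanMatrix` and `Qs` is the Bellman fixed point. Because `c ≤ ρ`, the matrix `M̄` is entrywise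
nonnegative, and its row sums are at most `1 - ω` (`meanMatrix_nonneg`, `sum_meanMatrix_le`). It is
therefore a sup-norm contraction, but the squared sup norm is not smooth and cannot itself serve as
a Lyapunov function for a noisy recursion.

`exists_lyapunov` replaces it by the squared weighted `ℓ^p` norm with `p = 2 (r + 1)`. The weight
`μ` satisfies `μ M̄ ≤ (1 - ω / 2) μ`, so Young's inequality gives a drift of rate `ω` for every such
`p`. The smoothness constant is `p - 1`, and the function is within a factor `2` of the squared sup
norm once `2 ^ (p / 2)` exceeds `2 |S| |A| / ω`. Hence `p` is of order `log (2 |S| |A| / ω)`, the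
source of the logarithm in the bound.

The noise is Markovian, so it is evaluated at the iterate `Q_j` from one lag earlier. That iterate
depends on the path up to time `j + n` only. After `t + 1` more steps the state-action chain is
entrywise within `2 α` of its stationary law, so the noise is almost uncorrelated with `Q_j`
(`integral_dotProduct_noise_le`). Replacing the current iterate by `Q_j` costs a term of order `α`
times the lag (`norm_tdIterate_sub_le`, `lyapunov_step_le`). The resulting recursion
(`integral_lyapunov_succ_le`) contracts by `1 - ω α / 2` under the stepsize condition and is then
unrolled.

The two uniqueness claims are separate: Doeblin's contraction of a positive power of `P`, and
Banach's theorem for the Bellman operator. -/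

namespace OffPolicyTD

/-! ### Finite Markov chains: positivity of powers, stationary law, mixing time. -/

section ChainTheory

open Matrix

variable {S : Type*} [Fintype S] [DecidableEq S]

/-- The powers of a nonnegative irreducible aperiodic matrix are eventually entrywise positive. -/
theorem exists_pow_pos_of_isIrreducible_of_isAperiodic {P : Matrix S S ℝ}
    (hirr : P.IsIrreducible) (haper : IsAperiodic P) :
    ∃ N : ℕ, ∀ s t, 0 < (P ^ N) s t := by
  have hnn := hirr.nonneg
  have hpow := (isIrreducible_iff_exists_pow_pos hnn).1 hirr
  have hmul : ∀ (i j : ℕ) (a b c : S), 0 < (P ^ i) a b → 0 < (P ^ j) b c →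
      0 < (P ^ (i + j)) a c := by
    intro i j a b c h₁ h₂
    rw [pow_add, mul_apply]
    exact (mul_pos h₁ h₂).trans_le (Finset.single_le_sum
      (f := fun x => (P ^ i) a x * (P ^ j) x c)
      (fun x _ => mul_nonneg (pow_apply_nonneg hnn i a x) (pow_apply_nonneg hnn j x c))
      (Finset.mem_univ b))
  have hret : ∀ s, ∃ n : ℕ, ∀ m ≥ n, 0 < (P ^ m) s s := by
    intro s
    -- The return times to `s` are closed under addition and have gcd `1`, so they contain all large
    -- integers.
    let R : Set ℕ := {k | 1 ≤ k ∧ 0 < (P ^ k) s s}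
    have hR : Nat.setGcd R = 1 := haper s _ fun k hk hpos => Nat.setGcd_dvd_of_mem ⟨hk, hpos⟩
    obtain ⟨n, hn⟩ := Nat.exists_mem_closure_of_ge R
    refine ⟨n, fun m hm => ?_⟩
    refine AddSubmonoid.closure_induction (motive := fun k _ => 0 < (P ^ k) s s)
      (fun x hx => hx.2) (by simp) (fun i j _ _ hi hj => hmul i j s s s hi hj)
      (hn m hm (by simp [hR]))
  choose n hn using hret
  choose k hk using fun s t => hpow s t
  -- A common exponent for all pairs: loop at `s` for the first `N - k s t ≥ n s` steps, then follow
  -- the chosen connection to `t`.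
  refine ⟨(∑ s, n s) + ∑ s, ∑ t, k s t, fun s t => ?_⟩
  have h₁ : n s ≤ ∑ s, n s := Finset.single_le_sum (fun _ _ => Nat.zero_le _) (Finset.mem_univ s)
  have h₂ : k s t ≤ ∑ s, ∑ t, k s t :=
    (Finset.single_le_sum (f := fun t => k s t) (fun _ _ => Nat.zero_le _)
      (Finset.mem_univ t)).trans
    (Finset.single_le_sum (f := fun s => ∑ t, k s t) (fun _ _ => Nat.zero_le _)
      (Finset.mem_univ s))
  have := hmul ((∑ s, n s) + (∑ s, ∑ t, k s t) - k s t) (k s t) s s t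
    (hn s _ (by omega)) (hk s t).2
  rwa [Nat.sub_add_cancel (by omega)] at this

theorem abs_vecMul_le {S : Type*} [Fintype S] (v : S → ℝ) {P : Matrix S S ℝ}
    (hP : ∀ i j, 0 ≤ P i j) (t : S) :
    |(v ᵥ* P) t| ≤ ((fun s => |v s|) ᵥ* P) t := by
  simp only [vecMul, dotProduct]
  refine (Finset.abs_sum_le_sum_abs _ _).trans (Finset.sum_le_sum fun s _ => ?_)
  rw [abs_mul, abs_of_nonneg (hP s t)]

theorem sum_vecMul_of_mem_rowStochastic {P : Matrix S S ℝ} (hP : P ∈ rowStochastic ℝ S)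
    (v : S → ℝ) : ∑ t, (v ᵥ* P) t = ∑ s, v s := by
  simp only [vecMul, dotProduct]
  rw [Finset.sum_comm]
  refine Finset.sum_congr rfl fun s _ => ?_
  rw [← Finset.mul_sum, sum_row_of_mem_rowStochastic hP, mul_one]

/-- `P - 1` kills the constant vector, so it also has a nonzero left null vector `v`. Then `|v| ≤
|v| P` entrywise while both sides have the same total mass; equality follows, and `|v|` can be
normalized. -/
theorem exists_isStationary [Nonempty S] {P : Matrix S S ℝ} (hP : P ∈ rowStochastic ℝ S) :
    ∃ κ, IsStationary P κ := by
  have hdet : (P - 1).det = 0 := by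
    refine (Matrix.exists_mulVec_eq_zero_iff).1 ⟨1, one_ne_zero, ?_⟩
    rw [sub_mulVec, hP.2, one_mulVec, sub_self]
  obtain ⟨v, hv, hvP⟩ := Matrix.exists_vecMul_eq_zero_iff.2 hdet
  rw [vecMul_sub, vecMul_one, sub_eq_zero] at hvP
  have hle : ∀ t, |v t| ≤ ((fun s => |v s|) ᵥ* P) t := fun t => by
    have := abs_vecMul_le v hP.1 t
    rwa [hvP] at this
  have heq : (fun s => |v s|) ᵥ* P = fun s => |v s| := by
    have hs := sum_vecMul_of_mem_rowStochastic hP (fun s => |v s|)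
    have := (Finset.sum_eq_sum_iff_of_le (fun t _ => hle t)).1 hs.symm
    exact funext fun t => (this t (Finset.mem_univ t)).symm
  have hpos : 0 < ∑ s, |v s| := by
    obtain ⟨s, hs⟩ := Function.ne_iff.1 hv
    exact Finset.sum_pos' (fun _ _ => abs_nonneg _) ⟨s, Finset.mem_univ s, abs_pos.2 hs⟩
  refine ⟨(∑ s, |v s|)⁻¹ • fun s => |v s|, ⟨fun s => ?_, ?_⟩, ?_⟩
  · exact mul_nonneg (inv_nonneg.2 hpos.le) (abs_nonneg _)
  · simp only [Pi.smul_apply, smul_eq_mul, ← Finset.mul_sum]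
    exact inv_mul_cancel₀ hpos.ne'
  · rw [smul_vecMul, heq]

theorem IsStationary.vecMul_pow {P : Matrix S S ℝ} {κ : S → ℝ} (h : IsStationary P κ) (k : ℕ) :
    κ ᵥ* P ^ k = κ := by
  induction k with
  | zero => simp
  | succ k ih => rw [pow_succ, ← vecMul_vecMul, ih, h.2]

/-- Doeblin's contraction: a stochastic matrix whose entries are at least `δ` contracts the
`ℓ¹` norm on vectors of total mass zero. -/
theorem sum_abs_vecMul_le {P : Matrix S S ℝ} (hP : P ∈ rowStochastic ℝ S) {δ : ℝ}
    (hδ : ∀ s t, δ ≤ P s t) (v : S → ℝ) (hv : ∑ s, v s = 0) :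
    ∑ t, |(v ᵥ* P) t| ≤ (1 - Fintype.card S * δ) * ∑ s, |v s| := by
  -- Subtracting `δ` from every entry does not change `v P`, as `v` has mass zero. What remains is
  -- nonnegative with row sums `1 - |S| δ`.
  have h : ∀ t, (v ᵥ* P) t = (v ᵥ* (P - of fun _ _ => δ : Matrix S S ℝ)) t := by
    intro t
    have : (v ᵥ* (of fun _ _ => δ : Matrix S S ℝ)) t = 0 := by
      simp [vecMul, dotProduct, ← Finset.sum_mul, hv]
    rw [vecMul_sub, Pi.sub_apply, this, sub_zero]
  have hnn : ∀ s t, 0 ≤ (P - of fun _ _ => δ : Matrix S S ℝ) s t := fun s t => by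
    simpa using hδ s t
  calc ∑ t, |(v ᵥ* P) t| ≤ ∑ t, ((fun s => |v s|) ᵥ* (P - of fun _ _ => δ : Matrix S S ℝ)) t :=
        Finset.sum_le_sum fun t _ => by rw [h t]; exact abs_vecMul_le v hnn t
    _ = (1 - Fintype.card S * δ) * ∑ s, |v s| := by
        simp only [vecMul, dotProduct]
        rw [Finset.sum_comm, Finset.mul_sum]
        refine Finset.sum_congr rfl fun s _ => ?_
        rw [← Finset.mul_sum]
        simp [Finset.sum_sub_distrib, sum_row_of_mem_rowStochastic hP]
        ring

theorem exists_pos_le_entries {S : Type*} [Fintype S] [Nonempty S]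
    {P : Matrix S S ℝ} (h : ∀ s t, 0 < P s t) :
    ∃ δ, 0 < δ ∧ ∀ s t, δ ≤ P s t := by
  obtain ⟨x, hx⟩ := Finite.exists_min fun x : S × S => P x.1 x.2
  exact ⟨_, h x.1 x.2, fun s t => hx (s, t)⟩

theorem sum_abs_vecMul_pow_le {P : Matrix S S ℝ} (hP : P ∈ rowStochastic ℝ S) {δ : ℝ}
    (hδ : ∀ s t, δ ≤ P s t) (hδ' : 0 ≤ 1 - Fintype.card S * δ) (v : S → ℝ)
    (hv : ∑ s, v s = 0) (k : ℕ) :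
    ∑ t, |(v ᵥ* P ^ k) t| ≤ (1 - Fintype.card S * δ) ^ k * ∑ s, |v s| := by
  induction k with
  | zero => simp
  | succ k ih =>
    rw [pow_succ, ← vecMul_vecMul]
    refine (sum_abs_vecMul_le hP hδ _ ?_).trans ?_
    · rw [sum_vecMul_of_mem_rowStochastic (pow_mem hP k), hv]
    · rw [pow_succ', mul_assoc]
      exact mul_le_mul_of_nonneg_left ih hδ'

theorem card_mul_le_one {P : Matrix S S ℝ} [Nonempty S] (hP : P ∈ rowStochastic ℝ S) {δ : ℝ}
    (hδ : ∀ s t, δ ≤ P s t) : Fintype.card S * δ ≤ 1 := by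
  obtain ⟨s⟩ := ‹Nonempty S›
  rw [← sum_row_of_mem_rowStochastic hP s]
  calc (Fintype.card S : ℝ) * δ = ∑ _t : S, δ := by simp
    _ ≤ _ := Finset.sum_le_sum fun t _ => hδ s t

theorem IsStationary.pos {P : Matrix S S ℝ} {κ : S → ℝ} (h : IsStationary P κ) {N : ℕ}
    (hN : ∀ s t, 0 < (P ^ N) s t) (t : S) : 0 < κ t := by
  rw [← h.vecMul_pow N]
  have : ∃ s, 0 < κ s := by
    by_contra! hneg
    have h1 := h.1.2
    have := Finset.sum_nonpos fun s (_ : s ∈ Finset.univ) => hneg s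
    linarith
  obtain ⟨s, hs⟩ := this
  exact Finset.sum_pos' (fun u _ => mul_nonneg (h.1.1 u) (hN u t).le)
    ⟨s, Finset.mem_univ s, mul_pos hs (hN s t)⟩

/-- The difference of two stationary laws has mass zero and is fixed by `P ^ N`, which strictly
contracts such vectors in `ℓ¹`. -/
theorem IsStationary.unique [Nonempty S] {P : Matrix S S ℝ} (hP : P ∈ rowStochastic ℝ S) {N : ℕ}
    (hN : ∀ s t, 0 < (P ^ N) s t) {κ κ' : S → ℝ} (h : IsStationary P κ)
    (h' : IsStationary P κ') : κ = κ' := by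
  obtain ⟨δ, hδ0, hδ⟩ := exists_pos_le_entries hN
  have hz : ∑ s, (κ - κ') s = 0 := by
    simp [Finset.sum_sub_distrib, h.1.2, h'.1.2]
  have := sum_abs_vecMul_le (pow_mem hP N) hδ (κ - κ') hz
  rw [sub_vecMul, h.vecMul_pow, h'.vecMul_pow] at this
  have hd : 0 < (Fintype.card S : ℝ) * δ := mul_pos (by exact_mod_cast Fintype.card_pos) hδ0
  have h0 : ∑ s, |(κ - κ') s| = 0 := by
    have hnn : 0 ≤ ∑ s, |(κ - κ') s| := Finset.sum_nonneg fun _ _ => abs_nonneg _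
    nlinarith
  have := (Finset.sum_eq_zero_iff_of_nonneg fun s _ => abs_nonneg ((κ - κ') s)).1 h0
  funext s
  have := this s (Finset.mem_univ s)
  simpa [sub_eq_zero] using this

/-- The mixing time of a chain with an entrywise positive power is attained. -/
theorem tvDist_pow_mixingTime_le [Nonempty S] {P : Matrix S S ℝ} (hP : P ∈ rowStochastic ℝ S)
    {N : ℕ} (hN : ∀ s t, 0 < (P ^ N) s t) {κ : S → ℝ} (h : IsStationary P κ) {δ : ℝ}
    (hδ : 0 < δ) (s : S) : tvDist ((P ^ mixingTime P κ δ) s) κ ≤ δ := by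
  -- The infimum of an empty set of naturals is `0`, so the claim is exactly that some `k`
  -- qualifies.
  suffices hne : {k : ℕ | ∀ s, tvDist ((P ^ k) s) κ ≤ δ}.Nonempty from Nat.sInf_mem hne s
  obtain ⟨η, hη0, hη⟩ := exists_pos_le_entries hN
  have hd : 0 < (Fintype.card S : ℝ) * η := mul_pos (by exact_mod_cast Fintype.card_pos) hη0
  have hle := card_mul_le_one (pow_mem hP N) hη
  obtain ⟨k, hk⟩ := exists_pow_lt_of_lt_one hδ (show 1 - Fintype.card S * η < 1 by linarith)
  refine ⟨N * k, fun s => ?_⟩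
  -- The image of `e_s - κ` under `P ^ (N k)` is the row difference to be bounded. Its initial `ℓ¹`
  -- norm is at most `2`, which cancels the `1 / 2` in the total variation distance.
  let v : S → ℝ := Pi.single s 1 - κ
  have hv0 : ∑ t, v t = 0 := by
    simp [v, Finset.sum_sub_distrib, h.1.2]
  have hv2 : ∑ t, |v t| ≤ 2 := by
    calc ∑ t, |v t| ≤ ∑ t, ((Pi.single s (1 : ℝ) : S → ℝ) t + κ t) := by
          refine Finset.sum_le_sum fun t _ => (abs_sub _ _).trans ?_
          rw [abs_of_nonneg (h.1.1 t), abs_of_nonneg]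
          by_cases hts : t = s
          · subst hts; simp
          · simp [hts]
      _ = 2 := by simp [Finset.sum_add_distrib, h.1.2]; norm_num
  have key := sum_abs_vecMul_pow_le (pow_mem hP N) hη (by linarith) v hv0 k
  have hrow : ∀ t, (v ᵥ* (P ^ N) ^ k) t = (P ^ (N * k)) s t - κ t := by
    intro t
    rw [← pow_mul, sub_vecMul, h.vecMul_pow, Pi.sub_apply, single_one_vecMul]
    rfl
  simp only [hrow] at key
  have hp : 0 ≤ (1 - Fintype.card S * η) ^ k := pow_nonneg (by linarith) k
  unfold tvDist
  nlinarith

end ChainTheory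


/-! ### Smoothness of the squared weighted `ℓ^p` norm. -/

section Lyapunov

open Matrix Real

variable {ι : Type*} [Fintype ι]

/-- Weighted power sum `∑ μ_i x_i ^ (2 (r + 1))`. -/
noncomputable def powerSum (μ : ι → ℝ) (r : ℕ) (x : ι → ℝ) : ℝ := ∑ i, μ i * x i ^ (2 * (r + 1))

/-- Square of the weighted `ℓ^p` norm, `p = 2 (r + 1)`. -/
noncomputable def normSqLp (μ : ι → ℝ) (r : ℕ) (x : ι → ℝ) : ℝ :=
  powerSum μ r x ^ ((r + 1 : ℝ)⁻¹)

/-- Half of the gradient of `normSqLp`. -/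
noncomputable def dualityMap (μ : ι → ℝ) (r : ℕ) (x : ι → ℝ) : ι → ℝ := fun i =>
  powerSum μ r x ^ ((r + 1 : ℝ)⁻¹ - 1) * (μ i * x i ^ (2 * r + 1))

/-- Hölder with exponents `(q + 1) / q` and `q + 1`, obtained from the weighted power-mean
inequality with weights `μ a ^ (q + 1)` and function `b / a`. Where `a` vanishes the quotient is `0`
by convention; this is harmless when `q ≥ 1`, and `q = 0` is trivial. -/
theorem sum_weight_mul_pow_mul_le (μ a b : ι → ℝ) (hμ : ∀ i, 0 ≤ μ i) (ha : ∀ i, 0 ≤ a i)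
    (hb : ∀ i, 0 ≤ b i) (q : ℕ) :
    ∑ i, μ i * (a i ^ q * b i) ≤
      (∑ i, μ i * a i ^ (q + 1)) ^ (1 - (q + 1 : ℝ)⁻¹) *
        (∑ i, μ i * b i ^ (q + 1)) ^ ((q + 1 : ℝ)⁻¹) := by
  rcases Nat.eq_zero_or_pos q with rfl | hq
  · simp
  have h := inner_le_weight_mul_Lp_of_nonneg Finset.univ (p := (q + 1 : ℝ))
    (by linarith [(Nat.cast_nonneg q : (0 : ℝ) ≤ q)]) (fun i => μ i * a i ^ (q + 1))
    (fun i => b i / a i) (fun i => mul_nonneg (hμ i) (pow_nonneg (ha i) _))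
    (fun i => div_nonneg (hb i) (ha i))
  calc ∑ i, μ i * (a i ^ q * b i) = ∑ i, μ i * a i ^ (q + 1) * (b i / a i) := by
        refine Finset.sum_congr rfl fun i _ => ?_
        rcases (ha i).eq_or_lt with h0 | h0
        · simp [← h0, hq.ne']
        · field_simp
          ring
    _ ≤ _ := h
    _ ≤ _ := by
        refine mul_le_mul_of_nonneg_left (rpow_le_rpow ?_ ?_ (by positivity))
          (rpow_nonneg (Finset.sum_nonneg fun i _ =>
            mul_nonneg (hμ i) (pow_nonneg (ha i) _)) _)
        · exact Finset.sum_nonneg fun i _ => mul_nonneg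
            (mul_nonneg (hμ i) (pow_nonneg (ha i) _))
            (rpow_nonneg (div_nonneg (hb i) (ha i)) _)
        · refine Finset.sum_le_sum fun i _ => ?_
          have : ((q : ℝ) + 1) = ((q + 1 : ℕ) : ℝ) := by push_cast; ring
          rw [this, rpow_natCast]
          rcases (ha i).eq_or_lt with h0 | h0
          · simpa [← h0] using mul_nonneg (hμ i) (pow_nonneg (hb i) (q + 1))
          · apply le_of_eq
            rw [div_pow, mul_assoc, mul_div_cancel₀ _ (pow_pos h0 _).ne']

theorem powerSum_nonneg {μ : ι → ℝ} (hμ : ∀ i, 0 ≤ μ i) (r : ℕ) (x : ι → ℝ) :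
    0 ≤ powerSum μ r x :=
  Finset.sum_nonneg fun i _ => mul_nonneg (hμ i) (by rw [pow_mul]; positivity)

theorem normSqLp_nonneg {μ : ι → ℝ} (hμ : ∀ i, 0 ≤ μ i) (r : ℕ) (x : ι → ℝ) :
    0 ≤ normSqLp μ r x := rpow_nonneg (powerSum_nonneg hμ r x) _

theorem eq_zero_of_powerSum_eq_zero {μ : ι → ℝ} (hμ : ∀ i, 0 < μ i) {r : ℕ} {x : ι → ℝ}
    (h : powerSum μ r x = 0) : x = 0 := by
  funext i
  have h' := (Finset.sum_eq_zero_iff_of_nonneg fun i _ =>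
    mul_nonneg (hμ i).le (by rw [pow_mul]; positivity)).1 h i (Finset.mem_univ i)
  rcases mul_eq_zero.1 h' with h' | h'
  · exact absurd h' (hμ i).ne'
  · exact eq_zero_of_pow_eq_zero h'

theorem dualityMap_dotProduct (μ : ι → ℝ) (r : ℕ) (x y : ι → ℝ) :
    dualityMap μ r x ⬝ᵥ y =
      powerSum μ r x ^ ((r + 1 : ℝ)⁻¹ - 1) * ∑ i, μ i * (x i ^ (2 * r + 1) * y i) := by
  simp only [dotProduct, dualityMap, Finset.mul_sum]
  exact Finset.sum_congr rfl fun i _ => by ring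

theorem dualityMap_dotProduct_self {μ : ι → ℝ} (hμ : ∀ i, 0 < μ i) (r : ℕ) (x : ι → ℝ) :
    dualityMap μ r x ⬝ᵥ x = normSqLp μ r x := by
  rw [dualityMap_dotProduct]
  have : ∑ i, μ i * (x i ^ (2 * r + 1) * x i) = powerSum μ r x :=
    Finset.sum_congr rfl fun i _ => by ring
  rw [this, normSqLp]
  rcases (powerSum_nonneg (fun i => (hμ i).le) r x).eq_or_lt with h | h
  · have : ((r : ℝ) + 1)⁻¹ ≠ 0 := by positivity
    rw [← h, mul_zero, zero_rpow this]
  · nth_rewrite 2 [← rpow_one (powerSum μ r x)]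
    rw [← rpow_add h]; congr 1; ring

/-- Hölder's inequality, followed by the inequality of arithmetic and geometric means. -/
theorem two_mul_dualityMap_dotProduct_le {μ : ι → ℝ} (hμ : ∀ i, 0 < μ i) (r : ℕ) (x y : ι → ℝ) :
    2 * (dualityMap μ r x ⬝ᵥ y) ≤ normSqLp μ r x + normSqLp μ r y := by
  have hμ' : ∀ i, 0 ≤ μ i := fun i => (hμ i).le
  have hWy := powerSum_nonneg hμ' r y
  rcases (powerSum_nonneg hμ' r x).eq_or_lt with h | h
  · have hx := eq_zero_of_powerSum_eq_zero hμ h.symm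
    have := normSqLp_nonneg hμ' r y
    have := normSqLp_nonneg hμ' r x
    have h0 : dualityMap μ r x ⬝ᵥ y = 0 := by
      rw [dualityMap_dotProduct, hx]; simp
    rw [h0]; linarith
  have h1 := sum_weight_mul_pow_mul_le μ (fun i => |x i|) (fun i => |y i|) hμ'
    (fun i => abs_nonneg _) (fun i => abs_nonneg _) (2 * r + 1)
  have hE : Even (2 * r + 1 + 1) := ⟨r + 1, by ring⟩
  simp only [hE.pow_abs] at h1
  have h2 : ∑ i, μ i * (x i ^ (2 * r + 1) * y i) ≤
      ∑ i, μ i * (|x i| ^ (2 * r + 1) * |y i|) :=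
    Finset.sum_le_sum fun i _ => mul_le_mul_of_nonneg_left
      (by rw [← abs_pow, ← abs_mul]; exact le_abs_self _) (hμ' i)
  have h3 := h2.trans h1
  change _ ≤ powerSum μ r x ^ _ * powerSum μ r y ^ _ at h3
  set s : ℝ := (r + 1 : ℝ)⁻¹ with hs
  have hs' : (((2 * r + 1 : ℕ) : ℝ) + 1)⁻¹ = s / 2 := by
    push_cast; rw [hs]; field_simp; ring
  rw [hs'] at h3
  have h4 : dualityMap μ r x ⬝ᵥ y ≤ powerSum μ r x ^ (s / 2) * powerSum μ r y ^ (s / 2) := by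
    rw [dualityMap_dotProduct]
    refine (mul_le_mul_of_nonneg_left h3 (rpow_nonneg h.le _)).trans (le_of_eq ?_)
    rw [← mul_assoc, ← rpow_add h]
    congr 2; ring
  have hsq : ∀ z : ℝ, 0 ≤ z → z ^ s = (z ^ (s / 2)) ^ 2 := fun z hz => by
    rw [← rpow_natCast, ← rpow_mul hz]; congr 1; push_cast; ring
  rw [normSqLp, normSqLp, hsq _ h.le, hsq _ hWy]
  nlinarith [sq_nonneg (powerSum μ r x ^ (s / 2) - powerSum μ r y ^ (s / 2))]

/-- Along the segment `x + t y`, the second derivative of the regularized function is at most `2 (2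
r + 1) normSqLp μ r y`. Subtracting it from the matching quadratic leaves a convex function, whose
tangent at `0`, compared with its value at `1`, gives the bound. The shift by `ε` keeps the base of
the real power positive, hence everything differentiable. -/
theorem normSqLp_add_le_of_pos {μ : ι → ℝ} (hμ : ∀ i, 0 ≤ μ i) (r : ℕ) (x y : ι → ℝ) {ε : ℝ}
    (hε : 0 < ε) :
    (powerSum μ r (x + y) + ε) ^ ((r + 1 : ℝ)⁻¹) ≤
      (powerSum μ r x + ε) ^ ((r + 1 : ℝ)⁻¹) +
      2 * ((powerSum μ r x + ε) ^ ((r + 1 : ℝ)⁻¹ - 1) *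
        ∑ i, μ i * (x i ^ (2 * r + 1) * y i)) + (2 * r + 1) * normSqLp μ r y := by
  set s : ℝ := (r + 1 : ℝ)⁻¹ with hs
  have hr : (0 : ℝ) < r + 1 := by positivity
  have hs0 : 0 < s := by positivity
  have hs1 : s ≤ 1 := by
    rw [hs]; apply inv_le_one_of_one_le₀; linarith [(Nat.cast_nonneg r : (0 : ℝ) ≤ r)]
  have hrs : (r + 1 : ℝ) * s = 1 := mul_inv_cancel₀ hr.ne'
  let w₀ : ℝ → ℝ := fun t => ∑ i, μ i * (x i + t * y i) ^ (2 * (r + 1)) + ε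
  let w₁ : ℝ → ℝ := fun t => ∑ i, μ i * ((x i + t * y i) ^ (2 * r + 1) * y i)
  let w₂ : ℝ → ℝ := fun t => ∑ i, μ i * ((x i + t * y i) ^ (2 * r) * y i ^ 2)
  have hlin : ∀ i t, HasDerivAt (fun t => x i + t * y i) (y i) t := fun i t => by
    simpa using ((hasDerivAt_id t).mul_const (y i)).const_add (x i)
  have hw₀ : ∀ t, HasDerivAt w₀ (2 * (r + 1) * w₁ t) t := fun t => by
    have : HasDerivAt w₀ (∑ i, μ i * (((2 * (r + 1) : ℕ) : ℝ) *
        (x i + t * y i) ^ (2 * (r + 1) - 1) * y i)) t :=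
      (HasDerivAt.fun_sum fun i _ => ((hlin i t).pow _).const_mul (μ i)).add_const ε
    convert this using 1
    simp only [w₁, Finset.mul_sum]
    refine Finset.sum_congr rfl fun i _ => ?_
    rw [show 2 * (r + 1) - 1 = 2 * r + 1 by omega]
    push_cast; ring
  have hw₁ : ∀ t, HasDerivAt w₁ ((2 * r + 1) * w₂ t) t := fun t => by
    have : HasDerivAt w₁ (∑ i, μ i * (((2 * r + 1 : ℕ) : ℝ) *
        (x i + t * y i) ^ (2 * r + 1 - 1) * y i * y i)) t :=
      HasDerivAt.fun_sum fun i _ => (((hlin i t).pow _).mul_const (y i)).const_mul (μ i)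
    convert this using 1
    simp only [w₂, Finset.mul_sum]
    refine Finset.sum_congr rfl fun i _ => ?_
    rw [show 2 * r + 1 - 1 = 2 * r by omega]
    push_cast; ring
  have hpos : ∀ t, 0 < w₀ t := fun t => by
    have := powerSum_nonneg hμ r (fun i => x i + t * y i)
    unfold powerSum at this
    simp only [w₀]; linarith
  let g : ℝ → ℝ := fun t => (2 * r + 1) * normSqLp μ r y * t ^ 2 - w₀ t ^ s
  let g' : ℝ → ℝ := fun t =>
    (2 * r + 1) * normSqLp μ r y * (2 * t) - 2 * (w₁ t * w₀ t ^ (s - 1))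
  let g'' : ℝ → ℝ := fun t => (2 * r + 1) * normSqLp μ r y * 2 -
    2 * ((2 * r + 1) * w₂ t * w₀ t ^ (s - 1) +
      w₁ t * (2 * (r + 1) * w₁ t * (s - 1) * w₀ t ^ (s - 1 - 1)))
  have hg : ∀ t, HasDerivAt g (g' t) t := fun t => by
    have h1 := ((hasDerivAt_pow 2 t).const_mul ((2 * r + 1) * normSqLp μ r y)).sub
      ((hw₀ t).rpow_const (p := s) (Or.inl (hpos t).ne'))
    refine h1.congr_deriv ?_
    simp only [g']
    have : 2 * (↑r + 1) * w₁ t * s * w₀ t ^ (s - 1) =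
      ((r + 1) * s) * 2 * (w₁ t * w₀ t ^ (s - 1)) := by ring
    rw [this, hrs]; simp
  have hg' : ∀ t, HasDerivAt g' (g'' t) t := fun t => by
    have h1 := (((hasDerivAt_id t).const_mul 2).const_mul ((2 * r + 1) * normSqLp μ r y)).sub
      (((hw₁ t).mul ((hw₀ t).rpow_const (p := s - 1) (Or.inl (hpos t).ne'))).const_mul 2)
    refine h1.congr_deriv ?_
    simp [g'']
  -- Hölder applied to the squares `(x + t y) ^ 2` and `y ^ 2`; the factor `w₀ ^ (1 - s)` cancels
  -- `w₀ ^ (s - 1)`.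
  have hw₂ : ∀ t, w₂ t * w₀ t ^ (s - 1) ≤ normSqLp μ r y := fun t => by
    have h1 := sum_weight_mul_pow_mul_le μ (fun i => (x i + t * y i) ^ 2) (fun i => y i ^ 2) hμ
      (fun i => sq_nonneg _) (fun i => sq_nonneg _) r
    simp only [← pow_mul] at h1
    have h2 : w₂ t ≤ w₀ t ^ (1 - s) * normSqLp μ r y := by
      refine h1.trans (mul_le_mul_of_nonneg_right ?_ (normSqLp_nonneg hμ r y))
      refine rpow_le_rpow (powerSum_nonneg hμ r _) ?_ (by linarith)
      simp only [w₀]; linarith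
    refine (mul_le_mul_of_nonneg_right h2 (rpow_nonneg (hpos t).le _)).trans (le_of_eq ?_)
    rw [mul_right_comm, ← rpow_add (hpos t)]
    simp
  have hconv : ConvexOn ℝ Set.univ g := by
    refine convexOn_of_hasDerivWithinAt2_nonneg convex_univ
      (f' := g') (f'' := g'') (fun t _ => (hg t).continuousAt.continuousWithinAt)
      (fun t _ => (hg t).hasDerivWithinAt) (fun t _ => (hg' t).hasDerivWithinAt) fun t _ => ?_
    have h1 := mul_le_mul_of_nonneg_left (hw₂ t)
      (by positivity : (0 : ℝ) ≤ 2 * r + 1)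
    -- The remaining part of the second derivative has a favourable sign because `s ≤ 1`.
    have h2 : 0 ≤ w₁ t ^ 2 * ((1 - s) * (2 * (r + 1)) * w₀ t ^ (s - 1 - 1)) :=
      mul_nonneg (sq_nonneg _) (mul_nonneg (mul_nonneg (by linarith) (by positivity))
        (rpow_nonneg (hpos t).le _))
    simp only [g'']
    nlinarith
  have hfin := hconv.le_slope_of_hasDerivAt (Set.mem_univ 0) (Set.mem_univ 1) one_pos (hg 0)
  rw [slope_def_field] at hfin
  simp only [g, g', w₀, w₁, zero_mul, one_mul, add_zero] at hfin
  simp only [powerSum, Pi.add_apply]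
  norm_num at hfin
  linarith

end Lyapunov


/-! ### Contracting weights, comparison with the sup norm, and the drift. -/

section Lyapunov

open Matrix Real

variable {ι : Type*} [Fintype ι]

/-- Young's inequality with integer exponents. In the induction, the gap beyond the multiplied
hypothesis is `(q + 1) a ^ q (a - b) ^ 2`. -/
theorem succ_mul_pow_mul_le {a b : ℝ} (ha : 0 ≤ a) (hb : 0 ≤ b) (q : ℕ) :
    (q + 1) * (a ^ q * b) ≤ q * a ^ (q + 1) + b ^ (q + 1) := by
  induction q with
  | zero => simp
  | succ q ih =>
    have h1 := mul_le_mul_of_nonneg_right ih hb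
    have h2 : 0 ≤ (q + 1) * (a ^ q * (a - b) ^ 2) := by positivity
    have e1 : a ^ (q + 1 + 1) = a ^ q * a ^ 2 := by ring
    have e2 : a ^ (q + 1) = a ^ q * a := by ring
    have e3 : b ^ (q + 1 + 1) = b ^ (q + 1) * b := by ring
    rw [e2] at h1
    rw [e1, e2, e3]
    push_cast
    nlinarith

theorem sum_vecMul_le_of_rowSum_le {A : Matrix ι ι ℝ} {q : ℝ} (hA : ∀ i, ∑ j, A i j ≤ q)
    {v : ι → ℝ} (hv : ∀ i, 0 ≤ v i) : ∑ j, (v ᵥ* A) j ≤ q * ∑ i, v i := by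
  simp only [vecMul, dotProduct]
  rw [Finset.sum_comm, Finset.mul_sum]
  refine Finset.sum_le_sum fun i _ => ?_
  rw [← Finset.mul_sum, mul_comm]
  exact mul_le_mul_of_nonneg_right (hA i) (hv i)

/-- A nonnegative matrix with row sums at most `1 - ω` is, for all exponents at once, a
contraction of the weighted `ℓ^p` norm for the weight produced here. -/
theorem exists_weight_vecMul_le [DecidableEq ι] [Nonempty ι] {M : Matrix ι ι ℝ} {ω : ℝ}
    (hM : ∀ i j, 0 ≤ M i j) (hω : 0 < ω) (hω1 : ω ≤ 1) (hrow : ∀ i, ∑ j, M i j ≤ 1 - ω) :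
    ∃ μ : ι → ℝ, (∀ i, ω / (2 * Fintype.card ι) ≤ μ i) ∧ ∑ i, μ i = 1 ∧
      ∀ j, (μ ᵥ* M) j ≤ (1 - ω / 2) * μ j := by
  have hβ : 0 < 1 - ω / 2 := by linarith
  set β := 1 - ω / 2 with hβdef
  have hd : (0 : ℝ) < Fintype.card ι := by exact_mod_cast Fintype.card_pos
  -- The goal becomes `μ A ≤ μ`. The row sums of `A` are at most `q = (1 - ω) / (1 - ω / 2) < 1`, so
  -- a Neumann series started from the uniform vector `ν` solves it.
  let A : Matrix ι ι ℝ := β⁻¹ • M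
  let q : ℝ := β⁻¹ * (1 - ω)
  have hA : ∀ i j, 0 ≤ A i j := fun i j => mul_nonneg (inv_nonneg.2 hβ.le) (hM i j)
  have hAq : ∀ i, ∑ j, A i j ≤ q := fun i => by
    simp only [A, Matrix.smul_apply, smul_eq_mul, ← Finset.mul_sum]
    exact mul_le_mul_of_nonneg_left (hrow i) (inv_nonneg.2 hβ.le)
  have hq0 : 0 ≤ q := mul_nonneg (inv_nonneg.2 hβ.le) (by linarith)
  have hq1 : 1 - q = β⁻¹ * (ω / 2) := by
    simp only [q]; field_simp; rw [hβdef]; ring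
  have hq1' : q < 1 := by
    have : 0 < β⁻¹ * (ω / 2) := by positivity
    linarith
  let ν : ι → ℝ := fun _ => (Fintype.card ι : ℝ)⁻¹
  have hν : ∑ i, ν i = 1 := by simp [ν]
  have hnn : ∀ k i, 0 ≤ (ν ᵥ* A ^ k) i := fun k i =>
    Finset.sum_nonneg fun j _ => mul_nonneg (inv_nonneg.2 hd.le) (pow_apply_nonneg hA k j i)
  have hsum : ∀ k, ∑ i, (ν ᵥ* A ^ k) i ≤ q ^ k := by
    intro k
    induction k with
    | zero => simp [hν]
    | succ k ih =>
      rw [pow_succ, ← vecMul_vecMul]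
      refine (sum_vecMul_le_of_rowSum_le hAq (hnn k)).trans ?_
      rw [pow_succ']
      exact mul_le_mul_of_nonneg_left ih hq0
  -- A finite truncation suffices: multiplying by `A` shifts the sum, exchanging `ν` for `ν A ^ (K +
  -- 1)`, whose entries are at most `q ^ K` and so below `1 / |ι|`.
  obtain ⟨K, hK⟩ := exists_pow_lt_of_lt_one (inv_pos.2 hd) hq1'
  let μ : ι → ℝ := ∑ k ∈ Finset.range (K + 1), ν ᵥ* A ^ k
  have hμν : ∀ i, (Fintype.card ι : ℝ)⁻¹ ≤ μ i := fun i => by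
    simp only [μ, Finset.sum_apply]
    have := Finset.single_le_sum (f := fun k => (ν ᵥ* A ^ k) i) (fun k _ => hnn k i)
      (Finset.mem_range.2 (Nat.succ_pos K))
    simpa [ν] using this
  have hμA : ∀ j, (μ ᵥ* A) j ≤ μ j := fun j => by
    have h1 : μ ᵥ* A = ∑ k ∈ Finset.range (K + 1), ν ᵥ* A ^ (k + 1) := by
      simp only [μ, Matrix.sum_vecMul]
      exact Finset.sum_congr rfl fun k _ => by rw [vecMul_vecMul, ← pow_succ]
    have h2 : μ = ∑ k ∈ Finset.range K, ν ᵥ* A ^ (k + 1) + ν := by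
      simp only [μ]; rw [Finset.sum_range_succ', pow_zero, vecMul_one]
    rw [h1, Finset.sum_range_succ, h2, Pi.add_apply, Pi.add_apply, add_le_add_iff_left]
    have h3 : (ν ᵥ* A ^ (K + 1)) j ≤ q ^ (K + 1) :=
      (Finset.single_le_sum (f := fun i => (ν ᵥ* A ^ (K + 1)) i) (fun i _ => hnn _ i)
        (Finset.mem_univ j)).trans (hsum _)
    exact h3.trans ((pow_le_pow_of_le_one hq0 hq1'.le (Nat.le_succ K)).trans hK.le)
  have hμs : ∑ i, μ i ≤ 2 / ω := by
    simp only [μ, Finset.sum_apply]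
    rw [Finset.sum_comm]
    have h1 := Finset.sum_le_sum fun k (_ : k ∈ Finset.range (K + 1)) => hsum k
    have h2 : (∑ k ∈ Finset.range (K + 1), q ^ k) * (1 - q) ≤ 1 := by
      rw [geom_sum_mul_neg]; linarith [pow_nonneg hq0 (K + 1)]
    rw [hq1] at h2
    refine h1.trans ?_
    rw [le_div_iff₀ hω]
    have h3 : β * (β⁻¹ * (ω / 2)) = ω / 2 := by field_simp
    have h4 := mul_le_mul_of_nonneg_left h2 hβ.le
    have h5 : (∑ k ∈ Finset.range (K + 1), q ^ k) * (ω / 2) ≤ β := by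
      calc _ = β * ((∑ k ∈ Finset.range (K + 1), q ^ k) * (β⁻¹ * (ω / 2))) := by
            rw [mul_left_comm, h3]
        _ ≤ β * 1 := h4
        _ = β := mul_one β
    linarith
  have hμpos : 0 < ∑ i, μ i :=
    Finset.sum_pos (fun i _ => (inv_pos.2 hd).trans_le (hμν i)) Finset.univ_nonempty
  refine ⟨(∑ i, μ i)⁻¹ • μ, fun i => ?_, ?_, fun j => ?_⟩
  · have h1 : ω / 2 ≤ (∑ i, μ i)⁻¹ := by
      rw [show ω / 2 = (2 / ω)⁻¹ by rw [inv_div]]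
      exact inv_anti₀ hμpos hμs
    calc ω / (2 * Fintype.card ι) = (ω / 2) * (Fintype.card ι : ℝ)⁻¹ := by field_simp
      _ ≤ _ := mul_le_mul h1 (hμν i) (inv_nonneg.2 hd.le) (inv_nonneg.2 hμpos.le)
  · simp only [Pi.smul_apply, smul_eq_mul, ← Finset.mul_sum]
    exact inv_mul_cancel₀ hμpos.ne'
  · have h1 : (μ ᵥ* M) j = β * (μ ᵥ* A) j := by
      simp only [A, vecMul_smul, Pi.smul_apply, smul_eq_mul]; field_simp
    rw [smul_vecMul, Pi.smul_apply, Pi.smul_apply, h1, smul_eq_mul, smul_eq_mul]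
    have := mul_le_mul_of_nonneg_left (hμA j) (mul_nonneg (inv_nonneg.2 hμpos.le) hβ.le)
    linarith

/-- The limit `ε → 0` of the regularized inequality. At `x = 0`, where the negative power is
singular, the claim reduces to `1 ≤ 2 r + 1`. -/
theorem normSqLp_add_le {μ : ι → ℝ} (hμ : ∀ i, 0 < μ i) (r : ℕ) (x y : ι → ℝ) :
    normSqLp μ r (x + y) ≤ normSqLp μ r x + 2 * (dualityMap μ r x ⬝ᵥ y) +
      (2 * r + 1) * normSqLp μ r y := by
  have hμ' : ∀ i, 0 ≤ μ i := fun i => (hμ i).le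
  have hs0 : (0 : ℝ) < (r + 1 : ℝ)⁻¹ := by positivity
  rcases (powerSum_nonneg hμ' r x).eq_or_lt with h | h
  · have hx := eq_zero_of_powerSum_eq_zero hμ h.symm
    have h1 := normSqLp_nonneg hμ' r y
    have h2 := normSqLp_nonneg hμ' r x
    have h0 : dualityMap μ r x ⬝ᵥ y = 0 := by
      rw [dualityMap_dotProduct, hx]; simp
    rw [h0, hx, zero_add]
    rw [hx] at h2
    have : 0 ≤ (2 * r : ℝ) * normSqLp μ r y := by positivity
    linarith
  · rw [dualityMap_dotProduct]
    have hc : ∀ {w p : ℝ}, w ≠ 0 ∨ 0 < p →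
        Filter.Tendsto (fun ε : ℝ => (w + ε) ^ p) (nhdsWithin 0 (Set.Ioi 0)) (nhds (w ^ p)) := by
      intro w p hwp
      have : ContinuousAt (fun ε : ℝ => (w + ε) ^ p) 0 :=
        (continuousAt_const.add continuousAt_id).rpow_const (by simpa using hwp.imp_right le_of_lt)
      have := this.tendsto
      simp only [add_zero] at this
      exact this.mono_left nhdsWithin_le_nhds
    refine le_of_tendsto_of_tendsto (hc (Or.inr hs0))
      (((hc (Or.inr hs0)).add (((hc (Or.inl h.ne')).mul_const
        (∑ i, μ i * (x i ^ (2 * r + 1) * y i))).const_mul 2)).add_const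
          ((2 * r + 1) * normSqLp μ r y)) ?_
    filter_upwards [self_mem_nhdsWithin] with ε hε
    exact normSqLp_add_le_of_pos hμ' r x y hε

theorem normSqLp_le_norm_sq {μ : ι → ℝ} (hμ : ∀ i, 0 < μ i) (hμs : ∑ i, μ i = 1) (r : ℕ)
    (x : ι → ℝ) : normSqLp μ r x ≤ ‖x‖ ^ 2 := by
  have h1 : powerSum μ r x ≤ (‖x‖ ^ 2) ^ (r + 1) := by
    calc powerSum μ r x ≤ ∑ i, μ i * (‖x‖ ^ 2) ^ (r + 1) := by
          refine Finset.sum_le_sum fun i _ => mul_le_mul_of_nonneg_left ?_ (hμ i).le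
          rw [pow_mul, ← sq_abs]
          have := norm_le_pi_norm x i
          rw [norm_eq_abs] at this
          gcongr
      _ = _ := by rw [← Finset.sum_mul, hμs, one_mul]
  have h2 := rpow_le_rpow (powerSum_nonneg (fun i => (hμ i).le) r x) h1
    (by positivity : (0 : ℝ) ≤ (r + 1 : ℝ)⁻¹)
  rwa [show (r + 1 : ℝ) = ((r + 1 : ℕ) : ℝ) by push_cast; ring,
    pow_rpow_inv_natCast (sq_nonneg _) (Nat.succ_ne_zero r), Nat.cast_succ] at h2

/-- A single coordinate already gives `x i ^ p ≤ 2 ^ (r + 1) μ i x i ^ p ≤ (2 normSqLp μ r x) ^ (r +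
1)`; take the root of order `r + 1`. -/
theorem norm_sq_le_two_mul_normSqLp {μ : ι → ℝ} (hμ : ∀ i, 0 < μ i) {r : ℕ}
    (hμr : ∀ i, 1 ≤ 2 ^ (r + 1) * μ i) (x : ι → ℝ) : ‖x‖ ^ 2 ≤ 2 * normSqLp μ r x := by
  have hN := normSqLp_nonneg (fun i => (hμ i).le) r x
  have hW := powerSum_nonneg (fun i => (hμ i).le) r x
  have hpow : normSqLp μ r x ^ (r + 1) = powerSum μ r x := by
    rw [normSqLp, show (r + 1 : ℝ) = ((r + 1 : ℕ) : ℝ) by push_cast; ring,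
      rpow_inv_natCast_pow hW (Nat.succ_ne_zero r)]
  have h : ‖x‖ ≤ √(2 * normSqLp μ r x) := by
    refine (pi_norm_le_iff_of_nonneg (sqrt_nonneg _)).2 fun i => ?_
    rw [norm_eq_abs]
    refine abs_le_sqrt ?_
    refine le_of_pow_le_pow_left₀ (Nat.succ_ne_zero r) (by positivity) ?_
    rw [Nat.succ_eq_add_one, mul_pow, hpow, ← pow_mul]
    have h1 : μ i * x i ^ (2 * (r + 1)) ≤ powerSum μ r x :=
      Finset.single_le_sum (f := fun i => μ i * x i ^ (2 * (r + 1)))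
        (fun i _ => mul_nonneg (hμ i).le (by rw [pow_mul]; positivity)) (Finset.mem_univ i)
    have h2 : 0 ≤ x i ^ (2 * (r + 1)) := by rw [pow_mul]; positivity
    calc x i ^ (2 * (r + 1)) ≤ 2 ^ (r + 1) * μ i * x i ^ (2 * (r + 1)) :=
          le_mul_of_one_le_left h2 (hμr i)
      _ = 2 ^ (r + 1) * (μ i * x i ^ (2 * (r + 1))) := by ring
      _ ≤ _ := by gcongr
  have := pow_le_pow_left₀ (norm_nonneg x) h 2
  rwa [sq_sqrt (by positivity)] at this

/-- The optimal scale is `t = A / B`. Since either may vanish, both are first increased by `δ`,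
which then tends to `0`. This turns bounds by sums of squares into bounds by products of norms. -/
theorem le_mul_of_forall_scale {a A B K : ℝ} (hA : 0 ≤ A) (hB : 0 ≤ B)
    (h : ∀ t : ℝ, 0 < t → 2 * (t * a) ≤ K * (A ^ 2 + t ^ 2 * B ^ 2)) : a ≤ K * A * B := by
  have key : ∀ δ : ℝ, 0 < δ → a ≤ K * (A + δ) * (B + δ) + |K| * ((A + δ) * (B + δ) -  A * B) := by
    intro δ hδ
    have hA' : 0 < A + δ := by linarith
    have hB' : 0 < B + δ := by linarith
    have h1 := h ((A + δ) / (B + δ)) (div_pos hA' hB')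
    have h2 : A ^ 2 + ((A + δ) / (B + δ)) ^ 2 * B ^ 2 ≤ 2 * (A + δ) ^ 2 := by
      have : (A + δ) / (B + δ) * B ≤ A + δ := by
        rw [div_mul_eq_mul_div, div_le_iff₀ hB']; nlinarith
      have h3 : 0 ≤ (A + δ) / (B + δ) * B := by positivity
      nlinarith
    have h4 : (A ^ 2 + ((A + δ) / (B + δ)) ^ 2 * B ^ 2) * ((B + δ) / (A + δ)) ≥ 2 * (A * B) := by
      have : (A ^ 2 + ((A + δ) / (B + δ)) ^ 2 * B ^ 2) * ((B + δ) / (A + δ)) - 2 * (A * B) =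
        (A - (A + δ) / (B + δ) * B) ^ 2 * ((B + δ) / (A + δ)) := by
        field_simp; ring
      have h5 : 0 ≤ (A - (A + δ) / (B + δ) * B) ^ 2 * ((B + δ) / (A + δ)) := by positivity
      linarith
    have h6 : (A ^ 2 + ((A + δ) / (B + δ)) ^ 2 * B ^ 2) * ((B + δ) / (A + δ)) ≤
        2 * ((A + δ) * (B + δ)) := by
      calc _ ≤ 2 * (A + δ) ^ 2 * ((B + δ) / (A + δ)) := by gcongr
        _ = _ := by field_simp
    have h7 : 2 * a ≤ K * ((A ^ 2 + ((A + δ) / (B + δ)) ^ 2 * B ^ 2) * ((B + δ) / (A + δ))) := by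
      have := mul_le_mul_of_nonneg_right h1 (div_pos hB' hA').le
      calc 2 * a = 2 * ((A + δ) / (B + δ) * a) * ((B + δ) / (A + δ)) := by field_simp
        _ ≤ _ := this
        _ = _ := by ring
    rcases le_total 0 K with hK | hK
    · have := mul_le_mul_of_nonneg_left h6 hK
      have : 0 ≤ |K| * ((A + δ) * (B + δ) -  A * B) := mul_nonneg (abs_nonneg _) (by nlinarith)
      linarith
    · have := mul_le_mul_of_nonpos_left h4 hK
      rw [abs_of_nonpos hK]
      nlinarith
  have hlim : Filter.Tendsto (fun δ : ℝ => K * (A + δ) * (B + δ) +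
      |K| * ((A + δ) * (B + δ) -  A * B)) (nhdsWithin 0 (Set.Ioi 0)) (nhds (K * A * B)) := by
    have : Continuous (fun δ : ℝ => K * (A + δ) * (B + δ) +
      |K| * ((A + δ) * (B + δ) -  A * B)) := by fun_prop
    have h1 := (this.tendsto 0).mono_left (nhdsWithin_le_nhds (s := Set.Ioi 0))
    simpa using h1
  refine ge_of_tendsto hlim ?_
  filter_upwards [self_mem_nhdsWithin] with δ hδ using key δ hδ

theorem dualityMap_dotProduct_le {μ : ι → ℝ} (hμ : ∀ i, 0 < μ i) (hμs : ∑ i, μ i = 1) (r : ℕ)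
    (x y : ι → ℝ) : dualityMap μ r x ⬝ᵥ y ≤ ‖x‖ * ‖y‖ := by
  have := le_mul_of_forall_scale (K := 1) (a := dualityMap μ r x ⬝ᵥ y) (norm_nonneg x)
    (norm_nonneg y) fun t ht => by
      have h1 := two_mul_dualityMap_dotProduct_le hμ r x (t • y)
      have h2 := normSqLp_le_norm_sq hμ hμs r x
      have h3 := normSqLp_le_norm_sq hμ hμs r (t • y)
      rw [norm_smul, norm_eq_abs, abs_of_pos ht, mul_pow] at h3
      rw [dotProduct_smul, smul_eq_mul] at h1
      linarith
  linarith

/-- A convex function with quadratic upper bounds has a Lipschitz gradient: the value at `x - w` is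
bounded above by expanding at `x` and then at `y`, and below by duality at `y`. -/
theorem dualityMap_sub_dotProduct_le {μ : ι → ℝ} (hμ : ∀ i, 0 < μ i) (hμs : ∑ i, μ i = 1) (r : ℕ)
    (x y w : ι → ℝ) :
    (dualityMap μ r x - dualityMap μ r y) ⬝ᵥ w ≤ (2 * r + 1) * ‖x - y‖ * ‖w‖ := by
  have key : ∀ w, 2 * ((dualityMap μ r x - dualityMap μ r y) ⬝ᵥ w) ≤
      (2 * r + 1) * (‖x - y‖ ^ 2 + ‖w‖ ^ 2) := by
    intro w
    have h1 := normSqLp_add_le hμ r x (-w)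
    have h2 := normSqLp_add_le hμ r y (x - y)
    have h3 := two_mul_dualityMap_dotProduct_le hμ r y (x + -w)
    have h4 := dualityMap_dotProduct_self hμ r y
    have h5 := mul_le_mul_of_nonneg_left (normSqLp_le_norm_sq hμ hμs r (x - y))
      (by positivity : (0 : ℝ) ≤ 2 * r + 1)
    have h6 := mul_le_mul_of_nonneg_left (normSqLp_le_norm_sq hμ hμs r (-w))
      (by positivity : (0 : ℝ) ≤ 2 * r + 1)
    rw [norm_neg] at h6
    rw [add_sub_cancel, dotProduct_sub] at h2
    rw [dotProduct_add] at h3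
    rw [dotProduct_neg] at h1 h3
    rw [sub_dotProduct]
    linarith
  refine le_mul_of_forall_scale (norm_nonneg _) (norm_nonneg _) fun t ht => ?_
  have := key (t • w)
  rwa [dotProduct_smul, smul_eq_mul, norm_smul, norm_eq_abs, abs_of_pos ht, mul_pow] at this

/-- Young's inequality splits each `x i ^ (p - 1) * x j` into a part in `x i`, summed by the row
sums of `M`, and a part in `x j`, summed by `μ M ≤ (1 - ω / 2) μ`. Their shares `p - 1` and `1` add
up to `p`. -/
theorem dualityMap_dotProduct_mulVec_sub_le {μ : ι → ℝ} (hμ : ∀ i, 0 < μ i) {M : Matrix ι ι ℝ}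
    {ω : ℝ} (hM : ∀ i j, 0 ≤ M i j) (hω : 0 ≤ ω) (hrow : ∀ i, ∑ j, M i j ≤ 1 - ω)
    (hμM : ∀ j, (μ ᵥ* M) j ≤ (1 - ω / 2) * μ j) (r : ℕ) (x : ι → ℝ) :
    dualityMap μ r x ⬝ᵥ (M *ᵥ x - x) ≤ -(ω / 2) * normSqLp μ r x := by
  have hμ' : ∀ i, 0 ≤ μ i := fun i => (hμ i).le
  have hW := powerSum_nonneg hμ' r x
  rw [dotProduct_sub, dualityMap_dotProduct_self hμ]
  suffices h : ∑ i, μ i * (x i ^ (2 * r + 1) * (M *ᵥ x) i) ≤ (1 - ω / 2) * powerSum μ r x by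
    rw [dualityMap_dotProduct]
    have h1 := mul_le_mul_of_nonneg_left h (rpow_nonneg hW ((r + 1 : ℝ)⁻¹ - 1))
    have h2 : powerSum μ r x ^ ((r + 1 : ℝ)⁻¹ - 1) * ((1 - ω / 2) * powerSum μ r x) =
        (1 - ω / 2) * normSqLp μ r x := by
      rw [← dualityMap_dotProduct_self hμ, dualityMap_dotProduct]
      have : ∑ i, μ i * (x i ^ (2 * r + 1) * x i) = powerSum μ r x :=
        Finset.sum_congr rfl fun i _ => by ring
      rw [this]; ring
    linarith
  have hp : (0 : ℝ) < 2 * r + 1 + 1 := by positivity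
  refine le_of_mul_le_mul_left ?_ hp
  have hE : Even (2 * r + 1 + 1) := ⟨r + 1, by ring⟩
  have hterm : ∀ i j, (2 * r + 1 + 1 : ℝ) * (μ i * (x i ^ (2 * r + 1) * (M i j * x j))) ≤
      (2 * r + 1) * (μ i * x i ^ (2 * (r + 1))) * M i j +
        (μ i * M i j) * x j ^ (2 * (r + 1)) := by
    intro i j
    have h1 := succ_mul_pow_mul_le (abs_nonneg (x i)) (abs_nonneg (x j)) (2 * r + 1)
    rw [hE.pow_abs, hE.pow_abs] at h1
    have h2 : x i ^ (2 * r + 1) * x j ≤ |x i| ^ (2 * r + 1) * |x j| := by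
      rw [← abs_pow, ← abs_mul]; exact le_abs_self _
    push_cast at h1
    have h3 := (mul_le_mul_of_nonneg_left h2 hp.le).trans h1
    have h4 := mul_le_mul_of_nonneg_left h3 (mul_nonneg (hμ' i) (hM i j))
    rw [show 2 * (r + 1) = 2 * r + 1 + 1 by ring]
    linarith
  calc (2 * r + 1 + 1 : ℝ) * ∑ i, μ i * (x i ^ (2 * r + 1) * (M *ᵥ x) i)
      = ∑ i, ∑ j, (2 * r + 1 + 1 : ℝ) * (μ i * (x i ^ (2 * r + 1) * (M i j * x j))) := by
        simp only [mulVec, dotProduct, Finset.mul_sum]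
    _ ≤ ∑ i, ∑ j, ((2 * r + 1) * (μ i * x i ^ (2 * (r + 1))) * M i j +
        (μ i * M i j) * x j ^ (2 * (r + 1))) :=
        Finset.sum_le_sum fun i _ => Finset.sum_le_sum fun j _ => hterm i j
    _ = ∑ i, (2 * r + 1) * (μ i * x i ^ (2 * (r + 1))) * ∑ j, M i j +
        ∑ j, (μ ᵥ* M) j * x j ^ (2 * (r + 1)) := by
        simp only [Finset.sum_add_distrib, Finset.mul_sum, vecMul, dotProduct, Finset.sum_mul]
        congr 1
        exact Finset.sum_comm
    _ ≤ ∑ i, (2 * r + 1) * (μ i * x i ^ (2 * (r + 1))) * (1 - ω / 2) +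
        ∑ j, (1 - ω / 2) * μ j * x j ^ (2 * (r + 1)) := by
        have hnn : ∀ i, 0 ≤ x i ^ (2 * (r + 1)) := fun i => by rw [pow_mul]; positivity
        refine add_le_add (Finset.sum_le_sum fun i _ => mul_le_mul_of_nonneg_left ?_ ?_)
          (Finset.sum_le_sum fun j _ => mul_le_mul_of_nonneg_right (hμM j) (hnn j))
        · linarith [hrow i]
        · exact mul_nonneg (by positivity) (mul_nonneg (hμ' i) (hnn i))
    _ = (2 * r + 1 + 1) * ((1 - ω / 2) * powerSum μ r x) := by
        simp only [powerSum, Finset.mul_sum, ← Finset.sum_add_distrib]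
        exact Finset.sum_congr rfl fun i _ => by ring

/-- A smooth Lyapunov function, comparable to the squared sup norm, for the linear system driven
by a nonnegative matrix with row sums at most `1 - ω`. -/
theorem exists_lyapunov [DecidableEq ι] [Nonempty ι] {M : Matrix ι ι ℝ} {ω : ℝ}
    (hM : ∀ i j, 0 ≤ M i j) (hω : 0 < ω) (hω1 : ω ≤ 1) (hrow : ∀ i, ∑ j, M i j ≤ 1 - ω) (r : ℕ)
    (hr : 2 * Fintype.card ι ≤ 2 ^ (r + 1) * ω) :
    ∃ (V : (ι → ℝ) → ℝ) (J : (ι → ℝ) → ι → ℝ), (∀ x, V x ≤ ‖x‖ ^ 2) ∧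
      (∀ x, ‖x‖ ^ 2 ≤ 2 * V x) ∧
      (∀ x y, V (x + y) ≤ V x + 2 * (J x ⬝ᵥ y) + (2 * r + 1) * V y) ∧
      (∀ x y, J x ⬝ᵥ y ≤ ‖x‖ * ‖y‖) ∧
      (∀ x y w, (J x - J y) ⬝ᵥ w ≤ (2 * r + 1) * ‖x - y‖ * ‖w‖) ∧
      ∀ x, J x ⬝ᵥ (M *ᵥ x - x) ≤ -(ω / 2) * V x := by
  obtain ⟨μ, hμω, hμs, hμM⟩ := exists_weight_vecMul_le hM hω hω1 hrow
  have hd : (0 : ℝ) < Fintype.card ι := by exact_mod_cast Fintype.card_pos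
  have hμ : ∀ i, 0 < μ i := fun i => (by positivity : 0 < ω / (2 * Fintype.card ι)).trans_le (hμω i)
  refine ⟨normSqLp μ r, dualityMap μ r, normSqLp_le_norm_sq hμ hμs r,
    norm_sq_le_two_mul_normSqLp hμ fun i => ?_, normSqLp_add_le hμ r,
    dualityMap_dotProduct_le hμ hμs r, dualityMap_sub_dotProduct_le hμ hμs r,
    dualityMap_dotProduct_mulVec_sub_le hμ hM hω.le hrow hμM r⟩
  refine le_trans ?_ (mul_le_mul_of_nonneg_left (hμω i) (by positivity))
  rw [← mul_div_assoc, le_div_iff₀ (by positivity), one_mul]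
  exact hr

end Lyapunov


/-! ### Markov chains and the Markov property in integrated form. -/

section Trajectory

open Matrix

variable {E Ω : Type*}

/-- The probability law of `X` is that of a (time-homogeneous) Markov chain with transition
matrix `P` and arbitrary initial distribution. -/
structure IsMarkovChain [MeasurableSpace Ω] (P : Matrix E E ℝ) (μ : Measure Ω)
    (X : ℕ → Ω → E) : Prop where
  measurableSet_fiber : ∀ k x, MeasurableSet {w | X k w = x}
  step : ∀ (k : ℕ) (h : ℕ → E),
    μ.real {w | ∀ i ≤ k + 1, X i w = h i} =
      μ.real {w | ∀ i ≤ k, X i w = h i} * P (h k) (h (k + 1))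

/-- Extension of a finite path by its last value. -/
def extendPath {N : ℕ} (p : Fin (N + 1) → E) (i : ℕ) : E :=
  p ⟨min i N, Nat.lt_succ_of_le (min_le_right i N)⟩

theorem extendPath_apply {N : ℕ} (h : ℕ → E) {i : ℕ} (hi : i ≤ N) :
    extendPath (fun j : Fin (N + 1) => h j) i = h i := by
  simp [extendPath, min_eq_left hi]

/-- A functional of finitely many coordinates on a finite alphabet is a finite combination of
cylinder indicators. Integrability and the Markov property thus reduce to cylinder probabilities. -/
theorem eq_sum_indicator_of_dependsOn [Fintype E] {N : ℕ} {F : (ℕ → E) → ℝ}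
    (hF : DependsOn F (Set.Iic N))
    (X : ℕ → Ω → E) (w : Ω) :
    F (fun i => X i w) = ∑ p : Fin (N + 1) → E, F (extendPath p) *
      Set.indicator {w | ∀ i ≤ N, X i w = extendPath p i} 1 w := by
  rw [Finset.sum_eq_single (fun j : Fin (N + 1) => X j w)]
  · rw [Set.indicator_of_mem]
    · rw [Pi.one_apply, mul_one]
      exact hF fun i hi => (extendPath_apply (fun i => X i w) hi).symm
    · exact fun i hi => (extendPath_apply (fun i => X i w) hi).symm
  · intro p _ hp
    rw [Set.indicator_of_notMem, mul_zero]
    intro h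
    apply hp
    funext j
    have := h j (Nat.le_of_lt_succ j.2)
    rw [this, extendPath]
    congr 1
    exact Fin.ext (min_eq_left (Nat.le_of_lt_succ j.2)).symm
  · exact fun h => absurd (Finset.mem_univ _) h

variable [MeasurableSpace Ω] {P : Matrix E E ℝ} {μ : Measure Ω} {X : ℕ → Ω → E}

theorem IsMarkovChain.measurableSet_cylinder (hX : IsMarkovChain P μ X) (N : ℕ) (h : ℕ → E) :
    MeasurableSet {w | ∀ i ≤ N, X i w = h i} := by
  have : {w | ∀ i ≤ N, X i w = h i} = ⋂ i ∈ Set.Iic N, {w | X i w = h i} := by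
    ext w; simp
  rw [this]
  exact MeasurableSet.biInter (Set.to_countable _) fun i _ => hX.measurableSet_fiber i (h i)

variable [Fintype E] [IsFiniteMeasure μ]

theorem IsMarkovChain.integrable (hX : IsMarkovChain P μ X) {N : ℕ}
    {F : (ℕ → E) → ℝ} (hF : DependsOn F (Set.Iic N)) :
    Integrable (fun w => F (fun i => X i w)) μ := by
  simp only [eq_sum_indicator_of_dependsOn hF X]
  exact integrable_finsetSum _ fun p _ =>
    ((integrable_const (1 : ℝ)).indicator (hX.measurableSet_cylinder N _)).const_mul _

theorem IsMarkovChain.integral_eq_sum (hX : IsMarkovChain P μ X) {N : ℕ}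
    {F : (ℕ → E) → ℝ} (hF : DependsOn F (Set.Iic N)) :
    ∫ w, F (fun i => X i w) ∂μ = ∑ p : Fin (N + 1) → E, F (extendPath p) *
      μ.real {w | ∀ i ≤ N, X i w = extendPath p i} := by
  simp only [eq_sum_indicator_of_dependsOn hF X]
  have hint : ∀ p : Fin (N + 1) → E, Integrable (fun w => F (extendPath p) *
      Set.indicator {w | ∀ i ≤ N, X i w = extendPath p i} (1 : Ω → ℝ) w) μ := fun p =>
    ((integrable_const (1 : ℝ)).indicator (hX.measurableSet_cylinder N _)).const_mul _
  rw [integral_finsetSum _ fun p _ => hint p]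
  refine Finset.sum_congr rfl fun p _ => ?_
  rw [integral_const_mul, integral_indicator_one (hX.measurableSet_cylinder N _)]

/-- The Markov property in integrated form. -/
theorem IsMarkovChain.integral_succ (hX : IsMarkovChain P μ X) {k : ℕ}
    {G : (ℕ → E) → E → ℝ} (hG : DependsOn G (Set.Iic k)) :
    ∫ w, G (fun i => X i w) (X (k + 1) w) ∂μ =
      ∫ w, (P *ᵥ G (fun i => X i w)) (X k w) ∂μ := by
  classical
  have hGy : ∀ y, DependsOn (fun h => G h y) (Set.Iic k) := fun y h h' hh =>
    congrFun (hG hh) y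
  have hcyl : ∀ (p : Fin (k + 1) → E) y w,
      Set.indicator {w | ∀ i ≤ k, X i w = extendPath p i} (1 : Ω → ℝ) w *
        (if X (k + 1) w = y then 1 else 0) =
      Set.indicator {w | ∀ i ≤ k + 1, X i w = Function.update (extendPath p) (k + 1) y i}
        (1 : Ω → ℝ) w := by
    intro p y w
    have hiff : (∀ i ≤ k + 1, X i w = Function.update (extendPath p) (k + 1) y i) ↔
        (∀ i ≤ k, X i w = extendPath p i) ∧ X (k + 1) w = y := by
      constructor
      · refine fun h => ⟨fun i hi => ?_, ?_⟩
        · have := h i (by omega)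
          rwa [Function.update_of_ne (by omega)] at this
        · have := h (k + 1) le_rfl
          rwa [Function.update_self] at this
      · rintro ⟨h1, h2⟩ i hi
        rcases Nat.lt_or_ge i (k + 1) with h | h
        · rw [Function.update_of_ne (by omega)]; exact h1 i (by omega)
        · obtain rfl : i = k + 1 := by omega
          rw [Function.update_self]; exact h2
    simp only [Set.indicator_apply, Set.mem_ofPred_eq, hiff, Pi.one_apply]
    by_cases h1 : ∀ i ≤ k, X i w = extendPath p i <;> by_cases h2 : X (k + 1) w = y <;>
      simp [h1, h2]
  have hmeas : ∀ (p : Fin (k + 1) → E) y, Integrable (fun w => G (extendPath p) y *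
      Set.indicator {w | ∀ i ≤ k + 1, X i w = Function.update (extendPath p) (k + 1) y i}
        (1 : Ω → ℝ) w) μ := fun p y =>
    ((integrable_const (1 : ℝ)).indicator (hX.measurableSet_cylinder _ _)).const_mul _
  have hpt : ∀ w, G (fun i => X i w) (X (k + 1) w) = ∑ y, ∑ p : Fin (k + 1) → E,
      G (extendPath p) y *
      Set.indicator {w | ∀ i ≤ k + 1, X i w = Function.update (extendPath p) (k + 1) y i}
        (1 : Ω → ℝ) w := by
    intro w
    have : G (fun i => X i w) (X (k + 1) w) =
        ∑ y, G (fun i => X i w) y * (if X (k + 1) w = y then 1 else 0) := by simp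
    rw [this]
    refine Finset.sum_congr rfl fun y _ => ?_
    rw [eq_sum_indicator_of_dependsOn (hGy y) X w, Finset.sum_mul]
    refine Finset.sum_congr rfl fun p _ => ?_
    rw [mul_assoc, hcyl]
  have hR : DependsOn (fun h : ℕ → E => (P *ᵥ G h) (h k)) (Set.Iic k) := fun h h' hh => by
    simp only [hG hh, hh k (Set.mem_Iic.2 le_rfl)]
  rw [hX.integral_eq_sum hR]
  simp only [hpt]
  rw [integral_finsetSum _ fun y _ => integrable_finsetSum _ fun p _ => hmeas p y,
    Finset.sum_congr rfl fun y _ => integral_finsetSum _ fun p _ => hmeas p y, Finset.sum_comm]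
  refine Finset.sum_congr rfl fun p _ => ?_
  simp only [mulVec, dotProduct, Finset.sum_mul]
  refine Finset.sum_congr rfl fun y _ => ?_
  rw [integral_const_mul, integral_indicator_one (hX.measurableSet_cylinder _ _), hX.step,
    Function.update_self, Function.update_of_ne (by omega)]
  have : {w | ∀ i ≤ k, X i w = Function.update (extendPath p) (k + 1) y i} =
      {w | ∀ i ≤ k, X i w = extendPath p i} := by
    ext w
    refine forall₂_congr fun i hi => ?_
    rw [Function.update_of_ne (by omega)]
  rw [this]
  ring

/-- Iterated Markov property with multiplicative weights collected along the path. -/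
theorem IsMarkovChain.integral_prod_mul [DecidableEq E] (hX : IsMarkovChain P μ X)
    (v : E → ℝ) (k i : ℕ) {F : (ℕ → E) → E → ℝ} (hF : DependsOn F (Set.Iic k)) :
    ∫ w, (∏ j ∈ Finset.Icc (k + 1) (k + i), v (X j w)) * F (fun j => X j w) (X (k + i) w) ∂μ =
      ∫ w, ((P * diagonal v) ^ i *ᵥ F (fun j => X j w)) (X k w) ∂μ := by
  induction i generalizing F with
  | zero => simp
  | succ i ih =>
    -- The last weight is absorbed into the function of the last state. One Markov step then
    -- replaces `F` by `(P * diagonal v) *ᵥ F`, to which the induction hypothesis applies.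
    have hG : DependsOn (fun (h : ℕ → E) (y : E) =>
        (∏ j ∈ Finset.Icc (k + 1) (k + i), v (h j)) * (v y * F h y)) (Set.Iic (k + i)) := by
      intro h h' hh
      have h1 : F h = F h' := hF fun j hj => hh j (Set.mem_Iic.2 (by
        have := Set.mem_Iic.1 hj; omega))
      have h2 : ∏ j ∈ Finset.Icc (k + 1) (k + i), v (h j) =
          ∏ j ∈ Finset.Icc (k + 1) (k + i), v (h' j) :=
        Finset.prod_congr rfl fun j hj => by rw [hh j (Set.mem_Iic.2 (Finset.mem_Icc.1 hj).2)]
      simp only [h1, h2]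
    have hF' : DependsOn (fun h : ℕ → E => (P * diagonal v) *ᵥ F h) (Set.Iic k) :=
      fun h h' hh => by simp only [hF hh]
    rw [pow_succ]
    simp only [← mulVec_mulVec]
    have h1 := hX.integral_succ hG
    have h2 := ih hF'
    simp only [← mulVec_mulVec] at h2
    rw [← h2]
    calc _ = _ := by
          congr 1
          funext w
          rw [← add_assoc, ← Finset.insert_Icc_right_eq_Icc_add_one (by omega),
            Finset.prod_insert (by simp)]
          ring
      _ = _ := h1
      _ = _ := by
          congr 1
          funext w
          simp only [mulVec, dotProduct, diagonal_apply, ite_mul, zero_mul, Finset.sum_ite_eq,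
            Finset.mem_univ, if_true, Finset.mul_sum]
          exact Finset.sum_congr rfl fun y _ => by ring

theorem IsMarkovChain.integral_add [DecidableEq E] (hX : IsMarkovChain P μ X)
    (k i : ℕ) {F : (ℕ → E) → E → ℝ} (hF : DependsOn F (Set.Iic k)) :
    ∫ w, F (fun j => X j w) (X (k + i) w) ∂μ =
      ∫ w, (P ^ i *ᵥ F (fun j => X j w)) (X k w) ∂μ := by
  have := hX.integral_prod_mul (fun _ => 1) k i hF
  simpa using this

end Trajectory


/-! ### Nonnegativity and row sums of the multistep operator. -/

section NonnegMatrix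

open Matrix

variable {ι : Type*} [Fintype ι]

theorem norm_mulVec_le_of_rowSum_le {A : Matrix ι ι ℝ} {q : ℝ} (hA : ∀ i j, 0 ≤ A i j)
    (hq : 0 ≤ q) (hrow : ∀ i, ∑ j, A i j ≤ q) (x : ι → ℝ) : ‖A *ᵥ x‖ ≤ q * ‖x‖ := by
  refine (pi_norm_le_iff_of_nonneg (by positivity)).2 fun i => ?_
  calc ‖(A *ᵥ x) i‖ ≤ ∑ j, ‖A i j * x j‖ := norm_sum_le _ _
    _ ≤ ∑ j, A i j * ‖x‖ := Finset.sum_le_sum fun j _ => by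
        rw [norm_mul, Real.norm_of_nonneg (hA i j)]
        exact mul_le_mul_of_nonneg_left (norm_le_pi_norm x j) (hA i j)
    _ ≤ q * ‖x‖ := by
        rw [← Finset.sum_mul]
        exact mul_le_mul_of_nonneg_right (hrow i) (norm_nonneg x)

variable [DecidableEq ι]

/-- The matrix `1 - (∑_{i < n} U ^ i) (1 - V)`, which governs the `n`-step expected update. -/
def multistep (n : ℕ) (U V : Matrix ι ι ℝ) : Matrix ι ι ℝ :=
  1 - (∑ i ∈ Finset.range n, U ^ i) * (1 - V)

theorem multistep_nonneg {U V : Matrix ι ι ℝ} (hU : ∀ i j, 0 ≤ U i j)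
    (hUV : ∀ i j, U i j ≤ V i j) (n : ℕ) (i j : ι) : 0 ≤ multistep n U V i j := by
  induction n generalizing i j with
  | zero =>
    simp only [multistep, Finset.range_zero, Finset.sum_empty, zero_mul, sub_zero, one_apply]
    split_ifs <;> norm_num
  | succ n ih =>
    -- This recursion displays the matrix as a sum of nonnegative terms, thanks to `U ≤ V`.
    have : multistep (n + 1) U V = (V - U) + U * multistep n U V := by
      simp only [multistep, Finset.sum_range_succ', pow_succ', pow_zero, ← Finset.mul_sum]
      noncomm_ring
    rw [this]
    refine add_nonneg (sub_nonneg.2 (hUV i j)) ?_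
    rw [mul_apply]
    exact Finset.sum_nonneg fun k _ => mul_nonneg (hU i k) (ih k j)

theorem pow_mul_le_pow_mulVec {U : Matrix ι ι ℝ} (hU : ∀ i j, 0 ≤ U i j) {u b : ℝ} (hu : 0 ≤ u)
    (hrow : ∀ i, u ≤ ∑ j, U i j) {x : ι → ℝ} (hb : 0 ≤ b) (hx : ∀ i, b ≤ x i) (k : ℕ) (i : ι) :
    u ^ k * b ≤ (U ^ k *ᵥ x) i := by
  induction k generalizing i with
  | zero => simpa using hx i
  | succ k ih =>
    rw [pow_succ' U, ← mulVec_mulVec, pow_succ', mul_assoc]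
    calc u * (u ^ k * b) ≤ (∑ j, U i j) * (u ^ k * b) :=
          mul_le_mul_of_nonneg_right (hrow i) (by positivity)
      _ ≤ _ := by
          rw [Finset.sum_mul]
          exact Finset.sum_le_sum fun j _ => mul_le_mul_of_nonneg_left (ih j) (hU i j)

/-- Row sums are values at the constant vector `1`. There `1 - V` gives at least `1 - v`, and each
`U ^ k` multiplies a lower bound by at least `u ^ k`. -/
theorem sum_multistep_le {U V : Matrix ι ι ℝ} (hU : ∀ i j, 0 ≤ U i j) {u v : ℝ} (hu : 0 ≤ u)
    (hv : v ≤ 1) (hrowU : ∀ i, u ≤ ∑ j, U i j) (hrowV : ∀ i, ∑ j, V i j ≤ v) (n : ℕ) (i : ι) :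
    ∑ j, multistep n U V i j ≤ 1 - (∑ k ∈ Finset.range n, u ^ k) * (1 - v) := by
  have h1 : ∑ j, multistep n U V i j = (multistep n U V *ᵥ 1) i := by simp [mulVec, dotProduct]
  have hx : ∀ i, 1 - v ≤ ((1 - V) *ᵥ (1 : ι → ℝ)) i := fun i => by
    have : ((1 - V) *ᵥ (1 : ι → ℝ)) i = 1 - ∑ j, V i j := by
      rw [sub_mulVec, one_mulVec]; simp [mulVec, dotProduct]
    rw [this]; linarith [hrowV i]
  rw [h1, multistep, sub_mulVec, one_mulVec, ← mulVec_mulVec, Pi.sub_apply, Pi.one_apply,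
    sub_le_sub_iff_left, Matrix.sum_mulVec, Finset.sum_apply, Finset.sum_mul]
  exact Finset.sum_le_sum fun k _ => pow_mul_le_pow_mulVec hU hu hrowU (by linarith) hx k i

end NonnegMatrix

theorem geomFactor_eq_sum (n : ℕ) (x : ℝ) : geomFactor n x = ∑ i ∈ Finset.range n, x ^ i := by
  unfold geomFactor
  split_ifs with h
  · simp [h]
  · rw [geom_sum_eq h, ← neg_sub, ← neg_sub x, neg_div_neg_eq]

/-! ### The state-action chain and the Bellman operator. -/

section MDP

open Matrix

variable {S A : Type*} [Fintype S] [DecidableEq S] [Fintype A]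

theorem stateChain_mem_rowStochastic (M : FiniteMDP S A) (πb : Policy S A) :
    stateChain M πb ∈ rowStochastic ℝ S := by
  rw [mem_rowStochastic_iff_sum]
  refine ⟨fun s t => Finset.sum_nonneg fun a _ => mul_nonneg ((πb.prob_mem s).1 a)
    (nonneg_of_mem_rowStochastic (M.trans_stochastic a)), fun s => ?_⟩
  simp only [stateChain, of_apply]
  rw [Finset.sum_comm]
  simp only [← Finset.mul_sum, sum_row_of_mem_rowStochastic (M.trans_stochastic _), mul_one]
  exact (πb.prob_mem s).2

/-- Transition matrix of the state-action chain `(S_k, A_k)` induced by a policy. -/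
def pairChain (M : FiniteMDP S A) (πb : Policy S A) : Matrix (S × A) (S × A) ℝ :=
  of fun x y => M.trans x.2 x.1 y.1 * πb.prob y.1 y.2

theorem IsTrajectory.isMarkovChain {Ω : Type*} [MeasurableSpace Ω] {M : FiniteMDP S A}
    {πb : Policy S A} {μ : Measure Ω} {X : ℕ → Ω → S × A} (hX : IsTrajectory M πb μ X) :
    IsMarkovChain (pairChain M πb) μ X :=
  ⟨hX.measurableSet_fiber, hX.step⟩

theorem pairChain_nonneg (M : FiniteMDP S A) (πb : Policy S A) (x y : S × A) :
    0 ≤ pairChain M πb x y :=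
  mul_nonneg (nonneg_of_mem_rowStochastic (M.trans_stochastic _)) ((πb.prob_mem _).1 _)

theorem sum_pairChain_mul (M : FiniteMDP S A) (πb : Policy S A) (x : S × A) (g : S × A → ℝ) :
    ∑ y, pairChain M πb x y * g y =
      ∑ s, M.trans x.2 x.1 s * ∑ a, πb.prob s a * g (s, a) := by
  rw [Fintype.sum_prod_type]
  simp only [pairChain, of_apply, Finset.mul_sum, mul_assoc]

theorem sum_pairChain (M : FiniteMDP S A) (πb : Policy S A) (x : S × A) :
    ∑ y, pairChain M πb x y = 1 := by
  have := sum_pairChain_mul M πb x 1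
  simpa [(πb.prob_mem _).2, sum_row_of_mem_rowStochastic (M.trans_stochastic _)] using this

variable [DecidableEq A]

/-- The first transition uses the given action; afterwards actions are drawn afresh, so the states
follow the state chain. The pair chain therefore mixes one step later than the state chain, hence
the `t + 1` below. -/
theorem pairChain_pow_succ (M : FiniteMDP S A) (πb : Policy S A) (t : ℕ) (x y : S × A) :
    (pairChain M πb ^ (t + 1)) x y =
      ∑ s, M.trans x.2 x.1 s * ((stateChain M πb ^ t) s y.1 * πb.prob y.1 y.2) := by
  induction t generalizing y with
  | zero => simp [pairChain, one_apply]
  | succ t ih =>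
    rw [pow_succ, mul_apply]
    simp only [ih]
    simp only [Finset.sum_mul]
    rw [Finset.sum_comm]
    refine Finset.sum_congr rfl fun s _ => ?_
    rw [pow_succ _ t, mul_apply, Fintype.sum_prod_type]
    simp only [stateChain, pairChain, of_apply, Finset.mul_sum, Finset.sum_mul]
    exact Finset.sum_congr rfl fun s' _ => Finset.sum_congr rfl fun a' _ => by ring

/-- One entry is at most the `ℓ¹` distance, which is twice the total variation. -/
theorem abs_pairChain_pow_sub_le (M : FiniteMDP S A) (πb : Policy S A) {κ : S → ℝ} {t : ℕ}
    {δ : ℝ} (h : ∀ s, tvDist ((stateChain M πb ^ t) s) κ ≤ δ) (x y : S × A) :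
    |(pairChain M πb ^ (t + 1)) x y - κ y.1 * πb.prob y.1 y.2| ≤ 2 * δ := by
  have hπ0 := (πb.prob_mem y.1).1 y.2
  have hπ1 : πb.prob y.1 y.2 ≤ 1 := by
    rw [← (πb.prob_mem y.1).2]
    exact Finset.single_le_sum (fun a _ => (πb.prob_mem y.1).1 a) (Finset.mem_univ _)
  have htr := sum_row_of_mem_rowStochastic (M.trans_stochastic x.2) x.1
  have hnn : ∀ s, 0 ≤ M.trans x.2 x.1 s := fun s =>
    nonneg_of_mem_rowStochastic (M.trans_stochastic x.2)
  have he : (pairChain M πb ^ (t + 1)) x y - κ y.1 * πb.prob y.1 y.2 =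
      ∑ s, M.trans x.2 x.1 s * (((stateChain M πb ^ t) s y.1 - κ y.1) * πb.prob y.1 y.2) := by
    rw [pairChain_pow_succ]
    simp only [sub_mul, mul_sub, Finset.sum_sub_distrib]
    rw [← Finset.sum_mul, htr, one_mul]
  rw [he]
  refine (Finset.abs_sum_le_sum_abs _ _).trans ?_
  calc _ ≤ ∑ s, M.trans x.2 x.1 s * (2 * δ) := by
        refine Finset.sum_le_sum fun s _ => ?_
        rw [abs_mul, abs_of_nonneg (hnn s), abs_mul, abs_of_nonneg hπ0]
        refine mul_le_mul_of_nonneg_left ?_ (hnn s)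
        have h1 : |(stateChain M πb ^ t) s y.1 - κ y.1| ≤ 2 * δ := by
          have h2 := h s
          unfold tvDist at h2
          have h3 := Finset.single_le_sum
            (f := fun s' => |(stateChain M πb ^ t) s s' - κ s'|)
            (fun _ _ => abs_nonneg _) (Finset.mem_univ y.1)
          linarith
        exact (mul_le_of_le_one_right (abs_nonneg _) hπ1).trans h1
    _ = 2 * δ := by rw [← Finset.sum_mul, htr, one_mul]

/-- The substochastic kernel of the state-action chain, weighted by `γ v`. -/
def weightedKernel (M : FiniteMDP S A) (πb : Policy S A) (v : S × A → ℝ) :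
    Matrix (S × A) (S × A) ℝ :=
  pairChain M πb * diagonal fun x => M.discount * v x

theorem weightedKernel_apply (M : FiniteMDP S A) (πb : Policy S A) (v : S × A → ℝ)
    (x y : S × A) :
    weightedKernel M πb v x y = pairChain M πb x y * (M.discount * v y) := by
  rw [weightedKernel, mul_diagonal]

theorem sum_weightedKernel (M : FiniteMDP S A) (πb : Policy S A) (v : S × A → ℝ) (x : S × A) :
    ∑ y, weightedKernel M πb v x y =
      ∑ s, M.trans x.2 x.1 s * (M.discount * diagD πb v s) := by
  simp only [weightedKernel_apply, sum_pairChain_mul, diagD, Finset.mul_sum]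
  exact Finset.sum_congr rfl fun s _ => Finset.sum_congr rfl fun a _ => by ring

theorem weightedKernel_nonneg (M : FiniteMDP S A) (πb : Policy S A) {v : S × A → ℝ}
    (hv : ∀ x, 0 ≤ v x) (x y : S × A) : 0 ≤ weightedKernel M πb v x y := by
  rw [weightedKernel_apply]
  exact mul_nonneg (pairChain_nonneg M πb x y) (mul_nonneg M.discount_mem.1.le (hv y))

theorem sum_weightedKernel_le (M : FiniteMDP S A) (πb : Policy S A) (v : S × A → ℝ) (x : S × A) :
    ∑ y, weightedKernel M πb v x y ≤ M.discount * ⨆ s, diagD πb v s := by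
  rw [sum_weightedKernel]
  calc _ ≤ ∑ s, M.trans x.2 x.1 s * (M.discount * ⨆ s, diagD πb v s) :=
        Finset.sum_le_sum fun s _ => mul_le_mul_of_nonneg_left
          (mul_le_mul_of_nonneg_left (le_ciSup (Set.finite_range _).bddAbove s)
            M.discount_mem.1.le) (nonneg_of_mem_rowStochastic (M.trans_stochastic x.2))
    _ = _ := by
        rw [← Finset.sum_mul, sum_row_of_mem_rowStochastic (M.trans_stochastic x.2), one_mul]

theorem le_sum_weightedKernel (M : FiniteMDP S A) (πb : Policy S A) (v : S × A → ℝ) (x : S × A) :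
    M.discount * ⨅ s, diagD πb v s ≤ ∑ y, weightedKernel M πb v x y := by
  rw [sum_weightedKernel]
  calc _ = ∑ s, M.trans x.2 x.1 s * (M.discount * ⨅ s, diagD πb v s) := by
        rw [← Finset.sum_mul, sum_row_of_mem_rowStochastic (M.trans_stochastic x.2), one_mul]
    _ ≤ _ := Finset.sum_le_sum fun s _ => mul_le_mul_of_nonneg_left
          (mul_le_mul_of_nonneg_left (ciInf_le (Set.finite_range _).bddBelow s)
            M.discount_mem.1.le) (nonneg_of_mem_rowStochastic (M.trans_stochastic x.2))

theorem bellmanOp_eq (M : FiniteMDP S A) (πb : Policy S A) (ρ Q : S × A → ℝ) :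
    bellmanOp M πb ρ Q = M.reward + weightedKernel M πb ρ *ᵥ Q := by
  funext x
  simp only [bellmanOp, Pi.add_apply, mulVec, dotProduct, weightedKernel_apply]
  congr 1
  have := sum_pairChain_mul M πb x fun y => ρ y * Q y
  rw [← this, Finset.mul_sum]
  exact Finset.sum_congr rfl fun y _ => by ring

theorem bellmanOp_sub_eq (M : FiniteMDP S A) (πb : Policy S A) {ρ Qs : S × A → ℝ}
    (h : bellmanOp M πb ρ Qs = Qs) (Q : S × A → ℝ) :
    bellmanOp M πb ρ Q - Q = -((1 - weightedKernel M πb ρ) *ᵥ (Q - Qs)) := by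
  have h1 : bellmanOp M πb ρ Q - bellmanOp M πb ρ Qs = weightedKernel M πb ρ *ᵥ (Q - Qs) := by
    rw [bellmanOp_eq, bellmanOp_eq, mulVec_sub]; abel
  rw [h] at h1
  rw [sub_mulVec, one_mulVec, ← h1]; abel

/-- The operator is affine with a nonnegative linear part whose row sums are at most `γ D_{ρ,max} <
1`, so Banach's theorem applies in the sup norm. -/
theorem existsUnique_bellmanOp_fixedPoint (M : FiniteMDP S A)
    (πb : Policy S A) {ρ : S × A → ℝ} (hρ : ∀ x, 0 ≤ ρ x)
    (hD : (⨆ s, diagD πb ρ s) < 1 / M.discount) : ∃! Qs, bellmanOp M πb ρ Qs = Qs := by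
  have hγ := M.discount_mem.1
  have hv0 : 0 ≤ M.discount * ⨆ s, diagD πb ρ s := mul_nonneg hγ.le
    (Real.iSup_nonneg fun s => Finset.sum_nonneg fun a _ =>
      mul_nonneg ((πb.prob_mem s).1 a) (hρ _))
  have hv1 : M.discount * ⨆ s, diagD πb ρ s < 1 := by
    rw [lt_div_iff₀ hγ] at hD; linarith
  have hc : ContractingWith ⟨_, hv0⟩ (bellmanOp M πb ρ) := by
    refine ⟨by exact_mod_cast hv1, LipschitzWith.of_dist_le_mul fun Q Q' => ?_⟩
    rw [dist_eq_norm, dist_eq_norm, bellmanOp_eq, bellmanOp_eq, add_sub_add_left_eq_sub,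
      ← mulVec_sub]
    exact norm_mulVec_le_of_rowSum_le (weightedKernel_nonneg M πb hρ) hv0
      (sum_weightedKernel_le M πb ρ) _
  exact ⟨hc.fixedPoint _, hc.fixedPoint_isFixedPt, fun Q hQ => hc.fixedPoint_unique hQ⟩

end MDP


theorem one_le_geomFactor {n : ℕ} (hn : 1 ≤ n) {x : ℝ} (hx : 0 ≤ x) : 1 ≤ geomFactor n x := by
  rw [geomFactor_eq_sum]
  have := Finset.single_le_sum (f := fun i => x ^ i) (fun i _ => pow_nonneg hx i)
    (Finset.mem_range.2 hn)
  simpa using this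

/-! ### The stochastic update: bounds, conditional mean, and mixing noise. -/

section TD

open Matrix

variable {S A : Type*} [Fintype S] [DecidableEq S]

/-- The accumulated multi-step temporal difference starting at time `k` along the path `x`. -/
def tdSum (M : FiniteMDP S A) (n : ℕ) (c ρ : S × A → ℝ) (x : ℕ → S × A) (k : ℕ)
    (Q : S × A → ℝ) : ℝ :=
  ∑ i ∈ Finset.Ico k (k + n),
    M.discount ^ (i - k) * (∏ j ∈ Finset.Icc (k + 1) i, c (x j)) *
      tdError M ρ (x i) (x (i + 1)) Q

theorem tdSum_eq (M : FiniteMDP S A) (n : ℕ) (c ρ : S × A → ℝ) (x : ℕ → S × A) (k : ℕ)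
    (Q : S × A → ℝ) :
    tdSum M n c ρ x k Q = ∑ i ∈ Finset.range n,
      (∏ j ∈ Finset.Icc (k + 1) (k + i), (M.discount * c (x j))) *
        tdError M ρ (x (k + i)) (x (k + i + 1)) Q := by
  rw [tdSum, Finset.sum_Ico_eq_sum_range, Nat.add_sub_cancel_left]
  refine Finset.sum_congr rfl fun i _ => ?_
  rw [Finset.prod_mul_distrib, Finset.prod_const, Nat.card_Icc]
  congr 3
  omega

theorem tdSum_congr (M : FiniteMDP S A) {n : ℕ} (c ρ : S × A → ℝ) {x y : ℕ → S × A} {k : ℕ}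
    (h : ∀ i ≤ k + n, x i = y i) : tdSum M n c ρ x k = tdSum M n c ρ y k := by
  funext Q
  rw [tdSum_eq, tdSum_eq]
  refine Finset.sum_congr rfl fun i hi => ?_
  have hi := Finset.mem_range.1 hi
  rw [h (k + i) (by omega), h (k + i + 1) (by omega)]
  congr 1
  refine Finset.prod_congr rfl fun j hj => ?_
  rw [h j (by have := (Finset.mem_Icc.1 hj).2; omega)]

theorem prod_weight_bounds [Finite A] (M : FiniteMDP S A) {c : S × A → ℝ} (hc : ∀ x, 0 ≤ c x)
    (x : ℕ → S × A) (k i : ℕ) :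
    0 ≤ ∏ j ∈ Finset.Icc (k + 1) (k + i), (M.discount * c (x j)) ∧
      ∏ j ∈ Finset.Icc (k + 1) (k + i), (M.discount * c (x j)) ≤
        (M.discount * ⨆ x, c x) ^ i := by
  have hγ := M.discount_mem.1.le
  refine ⟨Finset.prod_nonneg fun j _ => mul_nonneg hγ (hc _), ?_⟩
  refine (Finset.prod_le_prod (fun j _ => mul_nonneg hγ (hc _)) fun j _ =>
    mul_le_mul_of_nonneg_left (le_ciSup (Set.finite_range c).bddAbove (x j)) hγ).trans
    (le_of_eq ?_)
  rw [Finset.prod_const, Nat.card_Icc]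
  congr 1
  omega

/-- Lipschitz constant of the stochastic update. -/
noncomputable def updateBound (M : FiniteMDP S A) (n : ℕ) (c ρ : S × A → ℝ) : ℝ :=
  geomFactor n (M.discount * ⨆ x, c x) * (M.discount * (⨆ x, ρ x) + 1)

theorem one_le_updateBound (M : FiniteMDP S A) {n : ℕ} (hn : 1 ≤ n) {c ρ : S × A → ℝ}
    (hc : ∀ x, 0 ≤ c x) (hρ : ∀ x, 0 ≤ ρ x) : 1 ≤ updateBound M n c ρ := by
  have hγ := M.discount_mem.1.le
  have h1 := one_le_geomFactor hn (mul_nonneg hγ (Real.iSup_nonneg hc))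
  have h2 : 0 ≤ M.discount * ⨆ x, ρ x := mul_nonneg hγ (Real.iSup_nonneg hρ)
  exact one_le_mul_of_one_le_of_one_le h1 (by linarith)

/-- The direction of the asynchronous update at time `k` along the path `x`. -/
def tdUpdate [DecidableEq A] (M : FiniteMDP S A) (n : ℕ) (c ρ : S × A → ℝ) (x : ℕ → S × A) (k : ℕ)
    (Q : S × A → ℝ) : S × A → ℝ := Pi.single (x k) (tdSum M n c ρ x k Q)

theorem tdIterate_succ [DecidableEq A] (M : FiniteMDP S A) (n : ℕ) (c ρ : S × A → ℝ) (α : ℝ)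
    (Q₀ : S × A → ℝ) (x : ℕ → S × A) (k : ℕ) :
    tdIterate M n c ρ (fun _ => α) Q₀ x (k + 1) = tdIterate M n c ρ (fun _ => α) Q₀ x k +
      α • tdUpdate M n c ρ x k (tdIterate M n c ρ (fun _ => α) Q₀ x k) := by
  funext y
  rw [tdIterate]
  simp only [Pi.add_apply, Pi.smul_apply, smul_eq_mul, tdUpdate, Pi.single_apply, tdSum]
  split_ifs <;> simp

theorem dependsOn_tdUpdate [DecidableEq A] (M : FiniteMDP S A) (n : ℕ) (c ρ : S × A → ℝ) (k : ℕ) :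
    DependsOn (fun x : ℕ → S × A => tdUpdate M n c ρ x k) (Set.Iic (k + n)) := fun x y h => by
  funext Q
  simp only [tdUpdate, tdSum_congr M c ρ h, h k (Set.mem_Iic.2 (Nat.le_add_right k n))]

/-- The update looks `n` steps ahead, so the iterates are not adapted to the present time. This is
what puts `n` into the lag. -/
theorem dependsOn_tdIterate [DecidableEq A] (M : FiniteMDP S A) (n : ℕ) (c ρ : S × A → ℝ) (α : ℝ)
    (Q₀ : S × A → ℝ) (k : ℕ) :
    DependsOn (fun x : ℕ → S × A => tdIterate M n c ρ (fun _ => α) Q₀ x k)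
      (Set.Iic (k + n)) := by
  induction k with
  | zero => exact fun x y _ => rfl
  | succ k ih =>
    intro x y h
    have h' : ∀ i ∈ Set.Iic (k + n), x i = y i := fun i hi => h i (Set.mem_Iic.2 (by
      have := Set.mem_Iic.1 hi; omega))
    have h1 := ih h'
    have h2 := dependsOn_tdUpdate M n c ρ k h'
    dsimp only at h1 h2 ⊢
    rw [tdIterate_succ, tdIterate_succ, h1, h2]

variable [Fintype A]

theorem abs_tdError_sub_le (M : FiniteMDP S A) {ρ : S × A → ℝ} (hρ : ∀ x, 0 ≤ ρ x)
    (x y : S × A) (Q Q' : S × A → ℝ) :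
    |tdError M ρ x y Q - tdError M ρ x y Q'| ≤ (M.discount * (⨆ x, ρ x) + 1) * ‖Q - Q'‖ := by
  have hγ := M.discount_mem.1.le
  have h1 := norm_le_pi_norm (Q - Q') y
  have h2 := norm_le_pi_norm (Q - Q') x
  rw [Real.norm_eq_abs, Pi.sub_apply] at h1 h2
  have h3 : tdError M ρ x y Q - tdError M ρ x y Q' =
      M.discount * ρ y * (Q y - Q' y) - (Q x - Q' x) := by unfold tdError; ring
  rw [h3]
  refine (abs_sub _ _).trans ?_
  rw [abs_mul, abs_of_nonneg (mul_nonneg hγ (hρ y)), add_mul, one_mul]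
  refine add_le_add (mul_le_mul ?_ h1 (abs_nonneg _) ?_) h2
  · exact mul_le_mul_of_nonneg_left (le_ciSup (Set.finite_range ρ).bddAbove y) hγ
  · exact mul_nonneg hγ (Real.iSup_nonneg hρ)

theorem abs_tdError_le (M : FiniteMDP S A) {ρ : S × A → ℝ} (hρ : ∀ x, 0 ≤ ρ x)
    (x y : S × A) (Q : S × A → ℝ) :
    |tdError M ρ x y Q| ≤ (M.discount * (⨆ x, ρ x) + 1) * (‖Q‖ + 1) := by
  have h1 := abs_tdError_sub_le M hρ x y Q 0
  have h2 : 0 ≤ M.discount * ⨆ x, ρ x := mul_nonneg M.discount_mem.1.le (Real.iSup_nonneg hρ)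
  have h3 : |tdError M ρ x y 0| ≤ 1 := by
    simp only [tdError, Pi.zero_apply, mul_zero, add_zero, sub_zero]
    rw [abs_of_nonneg (M.reward_mem x).1]
    exact (M.reward_mem x).2
  rw [sub_zero] at h1
  have h4 := abs_sub_abs_le_abs_sub (tdError M ρ x y Q) (tdError M ρ x y 0)
  linarith

theorem abs_tdSum_le (M : FiniteMDP S A) (n : ℕ) {c ρ : S × A → ℝ}
    (hc : ∀ x, 0 ≤ c x) (hρ : ∀ x, 0 ≤ ρ x) (x : ℕ → S × A) (k : ℕ) (Q : S × A → ℝ) :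
    |tdSum M n c ρ x k Q| ≤ updateBound M n c ρ * (‖Q‖ + 1) := by
  rw [tdSum_eq, updateBound, geomFactor_eq_sum, mul_assoc, Finset.sum_mul]
  refine (Finset.abs_sum_le_sum_abs _ _).trans (Finset.sum_le_sum fun i _ => ?_)
  obtain ⟨h0, h1⟩ := prod_weight_bounds M hc x k i
  rw [abs_mul, abs_of_nonneg h0]
  exact mul_le_mul h1 (abs_tdError_le M hρ _ _ Q) (abs_nonneg _) (h0.trans h1)

theorem abs_tdSum_sub_le (M : FiniteMDP S A) (n : ℕ) {c ρ : S × A → ℝ}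
    (hc : ∀ x, 0 ≤ c x) (hρ : ∀ x, 0 ≤ ρ x) (x : ℕ → S × A) (k : ℕ) (Q Q' : S × A → ℝ) :
    |tdSum M n c ρ x k Q - tdSum M n c ρ x k Q'| ≤ updateBound M n c ρ * ‖Q - Q'‖ := by
  rw [tdSum_eq, tdSum_eq, ← Finset.sum_sub_distrib, updateBound, geomFactor_eq_sum, mul_assoc,
    Finset.sum_mul]
  refine (Finset.abs_sum_le_sum_abs _ _).trans (Finset.sum_le_sum fun i _ => ?_)
  obtain ⟨h0, h1⟩ := prod_weight_bounds M hc x k i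
  rw [← mul_sub, abs_mul, abs_of_nonneg h0]
  exact mul_le_mul h1 (abs_tdError_sub_le M hρ _ _ Q Q') (abs_nonneg _) (h0.trans h1)

variable [DecidableEq A]

theorem norm_tdUpdate_le (M : FiniteMDP S A) (n : ℕ) {c ρ : S × A → ℝ}
    (hc : ∀ x, 0 ≤ c x) (hρ : ∀ x, 0 ≤ ρ x) (x : ℕ → S × A) (k : ℕ) (Q : S × A → ℝ) :
    ‖tdUpdate M n c ρ x k Q‖ ≤ updateBound M n c ρ * (‖Q‖ + 1) := by
  rw [tdUpdate, Pi.norm_single]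
  exact abs_tdSum_le M n hc hρ x k Q

theorem norm_tdUpdate_sub_le (M : FiniteMDP S A) (n : ℕ) {c ρ : S × A → ℝ}
    (hc : ∀ x, 0 ≤ c x) (hρ : ∀ x, 0 ≤ ρ x) (x : ℕ → S × A) (k : ℕ) (Q Q' : S × A → ℝ) :
    ‖tdUpdate M n c ρ x k Q - tdUpdate M n c ρ x k Q'‖ ≤ updateBound M n c ρ * ‖Q - Q'‖ := by
  rw [tdUpdate, tdUpdate, ← Pi.single_sub, Pi.norm_single]
  exact abs_tdSum_sub_le M n hc hρ x k Q Q'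

/-- Conditional expectation of the accumulated temporal difference given the current state-action
pair. -/
def meanTdSum (M : FiniteMDP S A) (πb : Policy S A) (n : ℕ) (c ρ Q : S × A → ℝ) : S × A → ℝ :=
  (∑ i ∈ Finset.range n, weightedKernel M πb c ^ i) *ᵥ (bellmanOp M πb ρ Q - Q)

theorem meanTdSum_eq (M : FiniteMDP S A) (πb : Policy S A) (n : ℕ) (c : S × A → ℝ)
    {ρ Qs : S × A → ℝ} (h : bellmanOp M πb ρ Qs = Qs) (Q : S × A → ℝ) :
    meanTdSum M πb n c ρ Q =
      (multistep n (weightedKernel M πb c) (weightedKernel M πb ρ) - 1) *ᵥ (Q - Qs) := by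
  rw [meanTdSum, bellmanOp_sub_eq M πb h, mulVec_neg, mulVec_mulVec, multistep, sub_sub_cancel_left,
    neg_mulVec]

theorem pairChain_mulVec_tdError (M : FiniteMDP S A) (πb : Policy S A) (ρ Q : S × A → ℝ)
    (x : S × A) : (pairChain M πb *ᵥ fun y => tdError M ρ x y Q) x =
      (bellmanOp M πb ρ Q - Q) x := by
  simp only [mulVec, dotProduct, tdError, mul_sub, mul_add, Finset.sum_sub_distrib,
    Finset.sum_add_distrib, ← Finset.sum_mul, sum_pairChain, one_mul, Pi.sub_apply, bellmanOp_eq,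
    Pi.add_apply, weightedKernel_apply]
  congr 2
  exact Finset.sum_congr rfl fun y _ => by ring

variable {Ω : Type*} [MeasurableSpace Ω] {μ : Measure Ω} [IsFiniteMeasure μ]
  {X : ℕ → Ω → S × A}

/-- Integrating out the last transition of the `i`-th term turns the temporal difference into the
Bellman residual. Integrating out the weights between `k` and `k + i` then gives the `i`-th power of
the weighted kernel. -/
theorem integral_dotProduct_tdUpdate {M : FiniteMDP S A} {πb : Policy S A}
    (hX : IsMarkovChain (pairChain M πb) μ X) (n : ℕ) (c ρ : S × A → ℝ) (k : ℕ)
    {J Q : (ℕ → S × A) → S × A → ℝ} (hJ : DependsOn J (Set.Iic k))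
    (hQ : DependsOn Q (Set.Iic k)) :
    ∫ w, J (fun i => X i w) ⬝ᵥ tdUpdate M n c ρ (fun i => X i w) k (Q fun i => X i w) ∂μ =
      ∫ w, J (fun i => X i w) (X k w) *
        meanTdSum M πb n c ρ (Q fun i => X i w) (X k w) ∂μ := by
  let G : ℕ → (ℕ → S × A) → S × A → ℝ := fun i h y =>
    (∏ j ∈ Finset.Icc (k + 1) (k + i), (M.discount * c (h j))) *
      (J h (h k) * tdError M ρ (h (k + i)) y (Q h))
  let F : (ℕ → S × A) → S × A → ℝ := fun h y =>
    J h (h k) * (bellmanOp M πb ρ (Q h) - Q h) y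
  have hdep : ∀ {i : ℕ} {h h' : ℕ → S × A}, (∀ j ∈ Set.Iic (k + i), h j = h' j) →
      J h = J h' ∧ Q h = Q h' ∧ h k = h' k := fun {i h h'} hh => by
    have h1 : ∀ j ∈ Set.Iic k, h j = h' j := fun j hj => hh j (Set.mem_Iic.2 (by
      have := Set.mem_Iic.1 hj; omega))
    exact ⟨hJ h1, hQ h1, h1 k (Set.mem_Iic.2 le_rfl)⟩
  have hprod : ∀ {i : ℕ} {h h' : ℕ → S × A}, (∀ j ∈ Set.Iic (k + i), h j = h' j) →
      ∏ j ∈ Finset.Icc (k + 1) (k + i), (M.discount * c (h j)) =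
      ∏ j ∈ Finset.Icc (k + 1) (k + i), (M.discount * c (h' j)) := fun {i h h'} hh =>
    Finset.prod_congr rfl fun j hj => by rw [hh j (Set.mem_Iic.2 (Finset.mem_Icc.1 hj).2)]
  have hG : ∀ i, DependsOn (G i) (Set.Iic (k + i)) := fun i h h' hh => by
    obtain ⟨h1, h2, h3⟩ := hdep hh
    simp only [G, hprod hh, h1, h2, h3, hh (k + i) (Set.mem_Iic.2 le_rfl)]
  have hG' : ∀ i, DependsOn (fun h => G i h (h (k + i + 1))) (Set.Iic (k + i + 1)) :=
    fun i h h' hh => by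
      have h1 := hG i (fun j hj => hh j (Set.mem_Iic.2 (by
        have := Set.mem_Iic.1 hj; omega)))
      simp only [h1, hh (k + i + 1) (Set.mem_Iic.2 le_rfl)]
  have hF : DependsOn F (Set.Iic k) := fun h h' hh => by
    obtain ⟨h1, h2, h3⟩ := hdep (i := 0) hh
    simp only [F, h1, h2, h3]
  have hU : ∀ i, DependsOn (fun h : ℕ → S × A => (weightedKernel M πb c ^ i *ᵥ F h) (h k))
      (Set.Iic k) := fun i h h' hh => by
    simp only [hF hh, hh k (Set.mem_Iic.2 le_rfl)]
  have hterm : ∀ i, ∫ w, G i (fun j => X j w) (X (k + i + 1) w) ∂μ =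
      ∫ w, (weightedKernel M πb c ^ i *ᵥ F (fun j => X j w)) (X k w) ∂μ := fun i => by
    rw [hX.integral_succ (hG i), weightedKernel, ← hX.integral_prod_mul _ k i hF]
    congr 1
    funext w
    have : ∀ (a b : ℝ) (g : S × A → ℝ) z, (pairChain M πb *ᵥ fun y => a * (b * g y)) z =
        a * (b * (pairChain M πb *ᵥ g) z) := fun a b g z => by
      simp only [mulVec, dotProduct, Finset.mul_sum]
      exact Finset.sum_congr rfl fun y _ => by ring
    simp only [G, F]
    rw [this, pairChain_mulVec_tdError]
  have hL : ∀ w, J (fun i => X i w) ⬝ᵥ tdUpdate M n c ρ (fun i => X i w) k (Q fun i => X i w) =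
      ∑ i ∈ Finset.range n, G i (fun j => X j w) (X (k + i + 1) w) := fun w => by
    rw [tdUpdate, dotProduct_single, tdSum_eq, Finset.mul_sum]
    exact Finset.sum_congr rfl fun i _ => by simp only [G]; ring
  have hR : ∀ w, J (fun i => X i w) (X k w) * meanTdSum M πb n c ρ (Q fun i => X i w) (X k w) =
      ∑ i ∈ Finset.range n, (weightedKernel M πb c ^ i *ᵥ F (fun j => X j w)) (X k w) :=
    fun w => by
      rw [meanTdSum, Matrix.sum_mulVec, Finset.sum_apply, Finset.mul_sum]
      refine Finset.sum_congr rfl fun i _ => ?_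
      simp only [F, mulVec, dotProduct, Finset.mul_sum]
      exact Finset.sum_congr rfl fun y _ => by ring
  simp only [hL, hR]
  rw [integral_finsetSum _ fun i _ => hX.integrable (hG' i),
    integral_finsetSum _ fun i _ => hX.integrable (hU i)]
  exact Finset.sum_congr rfl fun i _ => hterm i

/-- Correlation of a past-measurable direction with the noise of the update, after the chain has
had time to mix. -/
theorem integral_dotProduct_noise_le {M : FiniteMDP S A} {πb : Policy S A}
    (hX : IsMarkovChain (pairChain M πb) μ X) (n : ℕ) (c ρ : S × A → ℝ) {κ : S → ℝ} {t : ℕ}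
    {δ : ℝ} (hδ : 0 ≤ δ) (hmix : ∀ s, tvDist ((stateChain M πb ^ t) s) κ ≤ δ) (m : ℕ)
    {J Q : (ℕ → S × A) → S × A → ℝ} {a b : (ℕ → S × A) → ℝ} (hJ : DependsOn J (Set.Iic m))
    (hQ : DependsOn Q (Set.Iic m)) (ha : DependsOn a (Set.Iic m)) (hb : DependsOn b (Set.Iic m))
    (ha0 : ∀ h, 0 ≤ a h)
    (hJa : ∀ h v, J h ⬝ᵥ v ≤ a h * ‖v‖)
    (hQb : ∀ h, ‖meanTdSum M πb n c ρ (Q h)‖ ≤ b h) :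
    ∫ w, J (fun i => X i w) ⬝ᵥ (tdUpdate M n c ρ (fun i => X i w) (m + (t + 1)) (Q fun i => X i w) -
      (fun y => κ y.1 * πb.prob y.1 y.2) * meanTdSum M πb n c ρ (Q fun i => X i w)) ∂μ ≤
      ∫ w, a (fun i => X i w) * (2 * δ * b fun i => X i w) ∂μ := by
  set k := m + (t + 1) with hk
  have hmk : Set.Iic m ⊆ Set.Iic k := Set.Iic_subset_Iic.2 (by omega)
  let κ' : S × A → ℝ := fun y => κ y.1 * πb.prob y.1 y.2
  let F : (ℕ → S × A) → S × A → ℝ := fun h => J h * meanTdSum M πb n c ρ (Q h)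
  have hF : DependsOn F (Set.Iic m) := fun h h' hh => by simp only [F, hJ hh, hQ hh]
  have hd1 : DependsOn (fun h => J h ⬝ᵥ tdUpdate M n c ρ h k (Q h)) (Set.Iic (k + n)) := by
    intro h h' hh
    have h1 : ∀ i ∈ Set.Iic m, h i = h' i := fun i hi => hh i (Set.mem_Iic.2 (by
      have := Set.mem_Iic.1 hi; omega))
    have h2 := dependsOn_tdUpdate M n c ρ k hh
    dsimp only at h2
    simp only [hJ h1, hQ h1, h2]
  have hd2 : DependsOn (fun h => J h ⬝ᵥ (κ' * meanTdSum M πb n c ρ (Q h))) (Set.Iic m) :=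
    fun h h' hh => by simp only [hJ hh, hQ hh]
  have hd3 : DependsOn (fun h : ℕ → S × A => (pairChain M πb ^ (t + 1) *ᵥ F h) (h m))
      (Set.Iic m) := fun h h' hh => by simp only [hF hh, hh m (Set.mem_Iic.2 le_rfl)]
  have hd4 : DependsOn (fun h => a h * (2 * δ * b h)) (Set.Iic m) :=
    fun h h' hh => by simp only [ha hh, hb hh]
  simp only [dotProduct_sub]
  rw [integral_sub (hX.integrable hd1) (hX.integrable hd2),
    integral_dotProduct_tdUpdate hX n c ρ k (hJ.mono hmk) (hQ.mono hmk)]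
  -- The update is already averaged down to its mean at `X k`; pulling this back to time `m` brings
  -- in `t + 1` steps of the chain, to be compared with the stationary law.
  have h1 := hX.integral_add m (t + 1) hF
  simp only [F, Pi.mul_apply] at h1
  rw [h1, ← integral_sub (hX.integrable hd3) (hX.integrable hd2)]
  refine integral_mono ((hX.integrable hd3).sub (hX.integrable hd2)) (hX.integrable hd4) fun w => ?_
  set h : ℕ → S × A := fun i => X i w
  dsimp only
  have h2 : (pairChain M πb ^ (t + 1) *ᵥ F h) (X m w) -
      J h ⬝ᵥ (κ' * meanTdSum M πb n c ρ (Q h)) =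
      J h ⬝ᵥ fun y => ((pairChain M πb ^ (t + 1)) (X m w) y - κ' y) *
        meanTdSum M πb n c ρ (Q h) y := by
    simp only [mulVec, dotProduct, F, Pi.mul_apply, ← Finset.sum_sub_distrib]
    exact Finset.sum_congr rfl fun y _ => by ring
  -- The bound `hJa` is dual to the sup norm, so an entrywise mixing estimate suffices and no factor
  -- of the dimension is lost.
  refine (le_of_eq h2).trans ((hJa h _).trans (mul_le_mul_of_nonneg_left ?_ (ha0 h)))
  have hb0 : 0 ≤ b h := (norm_nonneg _).trans (hQb h)
  refine (pi_norm_le_iff_of_nonneg (by positivity)).2 fun y => ?_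
  rw [norm_mul]
  exact mul_le_mul (abs_pairChain_pow_sub_le M πb hmix (X m w) y)
    ((norm_le_pi_norm _ y).trans (hQb h)) (norm_nonneg _) (by positivity)

end TD


/-! ### Stochastic approximation in one step, and contraction of the mean update. -/

open Matrix

theorem le_of_geometric_recursion {a : ℕ → ℝ} {q b : ℝ} (hq0 : 0 ≤ q) (hq1 : q < 1) (hb : 0 ≤ b)
    (h : ∀ j, a (j + 1) ≤ q * a j + b) (j : ℕ) : a j ≤ q ^ j * a 0 + b / (1 - q) := by
  have hq : 0 < 1 - q := by linarith
  induction j with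
  | zero => simpa using div_nonneg hb hq.le
  | succ j ih =>
    have h1 := mul_le_mul_of_nonneg_left ih hq0
    have h2 : q * (b / (1 - q)) + b = b / (1 - q) := by field_simp; ring
    rw [pow_succ']
    linarith [h j]

/-- One step of stochastic approximation, measured by a smooth Lyapunov function, with the noise
evaluated at an earlier iterate `x'`. -/
theorem lyapunov_step_le {ι : Type*} [Fintype ι] {V : (ι → ℝ) → ℝ} {J : (ι → ℝ) → ι → ℝ}
    {K ω α B ε r : ℝ} (hV : ∀ x, V x ≤ ‖x‖ ^ 2)
    (hsmooth : ∀ x y, V (x + y) ≤ V x + 2 * (J x ⬝ᵥ y) + K * V y)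
    (hJ : ∀ x y, J x ⬝ᵥ y ≤ ‖x‖ * ‖y‖)
    (hJlip : ∀ x y w, (J x - J y) ⬝ᵥ w ≤ K * ‖x - y‖ * ‖w‖)
    (hK : 0 ≤ K) (hα : 0 ≤ α) (hB : 1 ≤ B) (hε : 0 ≤ ε) (hε4 : ε ≤ 1 / 4) (hαε : 2 * (α * B) ≤ ε)
    {x x' g g' d d' : ι → ℝ} (hdrift : J x ⬝ᵥ d ≤ -(ω / 2) * V x) (hx : ‖x‖ ≤ r)
    (hxx' : ‖x - x'‖ ≤ 4 * ε * r) (hg : ‖g‖ ≤ B * r) (hgg' : ‖g - g'‖ ≤ B * ‖x - x'‖)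
    (hd : ‖d‖ ≤ 2 * ‖x‖) (hdd' : ‖d - d'‖ ≤ 2 * ‖x - x'‖) :
    V (x + α • g) ≤ (1 - α * ω) * V x + 2 * α * (J x' ⬝ᵥ (g' - d')) +
      α * (B * ε) * (49 / 2 * K + 48) * r ^ 2 := by
  have hr : 0 ≤ r := (norm_nonneg x).trans hx
  have hx' : ‖x'‖ ≤ 2 * r := by
    have h1 : ‖x'‖ ≤ ‖x‖ + ‖x - x'‖ := by
      rw [← norm_neg (x - x'), neg_sub]
      calc ‖x'‖ = ‖x + (x' - x)‖ := by congr 1; abel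
        _ ≤ _ := norm_add_le _ _
    nlinarith
  have h1 := hsmooth x (α • g)
  have h2 := mul_le_mul_of_nonneg_left (hV (α • g)) hK
  rw [norm_smul, Real.norm_of_nonneg hα] at h2
  have h3 : (α * ‖g‖) ^ 2 ≤ α * (B * ε) / 2 * r ^ 2 := by
    have e1 : α * ‖g‖ ≤ α * B * r := by
      rw [mul_assoc]; exact mul_le_mul_of_nonneg_left hg hα
    calc (α * ‖g‖) ^ 2 ≤ (α * B * r) ^ 2 := pow_le_pow_left₀ (by positivity) e1 2
      _ = (α * B * r ^ 2) * (α * B) := by ring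
      _ ≤ (α * B * r ^ 2) * (ε / 2) := mul_le_mul_of_nonneg_left (by linarith) (by positivity)
      _ = _ := by ring
  have h3' := mul_le_mul_of_nonneg_left h3 hK
  -- Mean drift at `x`, noise frozen at `x'`, and the errors from moving first `J`, then the noise,
  -- from `x` to `x'`. The errors give `2 (12 K + 24)`, and the quadratic term adds `K / 2`.
  have h4 : J x ⬝ᵥ g = J x ⬝ᵥ d + J x' ⬝ᵥ (g' - d') + (J x - J x') ⬝ᵥ (g - d) +
      J x' ⬝ᵥ ((g - g') - (d - d')) := by
    simp only [sub_dotProduct, dotProduct_sub]; ring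
  have h5 : (J x - J x') ⬝ᵥ (g - d) ≤ 12 * K * (B * ε) * r ^ 2 := by
    have e1 : ‖g - d‖ ≤ 3 * B * r := (norm_sub_le _ _).trans (by nlinarith)
    calc _ ≤ K * ‖x - x'‖ * ‖g - d‖ := hJlip _ _ _
      _ ≤ K * (4 * ε * r) * (3 * B * r) := by gcongr
      _ = _ := by ring
  have h6 : J x' ⬝ᵥ ((g - g') - (d - d')) ≤ 24 * (B * ε) * r ^ 2 := by
    have e1 : ‖(g - g') - (d - d')‖ ≤ 3 * B * (4 * ε * r) := by
      refine (norm_sub_le _ _).trans ?_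
      have : 0 ≤ ‖x - x'‖ := norm_nonneg _
      have e2 : B * ‖x - x'‖ + 2 * ‖x - x'‖ ≤ 3 * B * ‖x - x'‖ := by nlinarith
      have e3 : 3 * B * ‖x - x'‖ ≤ 3 * B * (4 * ε * r) := by gcongr
      linarith
    calc _ ≤ ‖x'‖ * ‖(g - g') - (d - d')‖ := hJ _ _
      _ ≤ (2 * r) * (3 * B * (4 * ε * r)) := by gcongr
      _ = _ := by ring
  rw [dotProduct_smul, smul_eq_mul, h4] at h1
  have h7 := mul_le_mul_of_nonneg_left (add_le_add (add_le_add hdrift h5) h6) hα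
  linarith

theorem stationary_pair_mem {S A : Type*} [Fintype S] [Fintype A] {πb : Policy S A} {κ : S → ℝ}
    (hκ : κ ∈ stdSimplex ℝ S) (x : S × A) :
    0 ≤ κ x.1 * πb.prob x.1 x.2 ∧ κ x.1 * πb.prob x.1 x.2 ≤ 1 := by
  have h1 : κ x.1 ≤ 1 := by
    rw [← hκ.2]; exact Finset.single_le_sum (fun s _ => hκ.1 s) (Finset.mem_univ _)
  have h2 : πb.prob x.1 x.2 ≤ 1 := by
    rw [← (πb.prob_mem x.1).2]
    exact Finset.single_le_sum (fun a _ => (πb.prob_mem x.1).1 a) (Finset.mem_univ _)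
  exact ⟨mul_nonneg (hκ.1 _) ((πb.prob_mem _).1 _),
    mul_le_one₀ h1 ((πb.prob_mem _).1 _) h2⟩

theorem norm_stationary_pair_mul_le {S A : Type*} [Fintype S] [Fintype A] {πb : Policy S A}
    {κ : S → ℝ} (hκ : κ ∈ stdSimplex ℝ S) (v : S × A → ℝ) :
    ‖(fun y => κ y.1 * πb.prob y.1 y.2) * v‖ ≤ ‖v‖ := by
  refine (pi_norm_le_iff_of_nonneg (norm_nonneg v)).2 fun y => ?_
  obtain ⟨h0, h1⟩ := stationary_pair_mem (πb := πb) hκ y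
  rw [Pi.mul_apply, norm_mul, Real.norm_of_nonneg h0]
  exact (mul_le_of_le_one_left (norm_nonneg _) h1).trans (norm_le_pi_norm v y)

section TD

variable {S A : Type*} [Fintype S] [DecidableEq S] [Fintype A]

theorem discount_mul_iSup_lt_one {M : FiniteMDP S A} {πb : Policy S A} {ρ : S × A → ℝ}
    (hD : (⨆ s, diagD πb ρ s) < 1 / M.discount) : M.discount * ⨆ s, diagD πb ρ s < 1 := by
  rw [lt_div_iff₀ M.discount_mem.1] at hD; linarith

theorem discount_mul_iInf_nonneg {M : FiniteMDP S A} {πb : Policy S A} {c : S × A → ℝ}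
    (hc : ∀ x, 0 ≤ c x) : 0 ≤ M.discount * ⨅ s, diagD πb c s :=
  mul_nonneg M.discount_mem.1.le (Real.iInf_nonneg fun s =>
    Finset.sum_nonneg fun a _ => mul_nonneg ((πb.prob_mem s).1 a) (hc _))

theorem contraction_factor_pos {M : FiniteMDP S A} {πb : Policy S A} {n : ℕ} {c ρ : S × A → ℝ}
    (hc : ∀ x, 0 ≤ c x) (hD : (⨆ s, diagD πb ρ s) < 1 / M.discount) (hn : 1 ≤ n) :
    0 < geomFactor n (M.discount * ⨅ s, diagD πb c s) *
        (1 - M.discount * ⨆ s, diagD πb ρ s) :=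
  mul_pos (one_pos.trans_le (one_le_geomFactor hn (discount_mul_iInf_nonneg hc)))
    (sub_pos.2 (discount_mul_iSup_lt_one hD))

variable [DecidableEq A]

/-- A discrete Grönwall estimate: over at most `N` steps `‖Q‖ + 1` can no more than double, so each
step moves by at most `2 α B (‖Q_j‖ + 1)`. -/
theorem norm_tdIterate_sub_le (M : FiniteMDP S A) (n : ℕ) {c ρ : S × A → ℝ} (hc : ∀ x, 0 ≤ c x)
    (hρ : ∀ x, 0 ≤ ρ x) {α : ℝ} (hα : 0 ≤ α) (Q₀ : S × A → ℝ) (x : ℕ → S × A) {N : ℕ}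
    (hB : 0 ≤ updateBound M n c ρ) (hN : α * updateBound M n c ρ * N ≤ 1 / 2) (j i : ℕ)
    (hi : i ≤ N) :
    ‖tdIterate M n c ρ (fun _ => α) Q₀ x (j + i) - tdIterate M n c ρ (fun _ => α) Q₀ x j‖ ≤
      2 * (α * updateBound M n c ρ) * i *
        (‖tdIterate M n c ρ (fun _ => α) Q₀ x j‖ + 1) := by
  set B := updateBound M n c ρ
  set Q := tdIterate M n c ρ (fun _ => α) Q₀ x with hQ
  induction i with
  | zero => simp
  | succ i ih =>
    have ih := ih (by omega)
    have hz : 0 ≤ ‖Q j‖ + 1 := by positivity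
    have hi' : α * B * i ≤ 1 / 2 := by
      refine le_trans (mul_le_mul_of_nonneg_left ?_ (mul_nonneg hα hB)) hN
      exact_mod_cast (by omega : i ≤ N)
    have h1 : ‖Q (j + i)‖ + 1 ≤ 2 * (‖Q j‖ + 1) := by
      have := norm_sub_norm_le (Q (j + i)) (Q j)
      have := mul_le_mul_of_nonneg_right hi' hz
      linarith
    have h2 : Q (j + (i + 1)) = Q (j + i) + α • tdUpdate M n c ρ x (j + i) (Q (j + i)) :=
      tdIterate_succ M n c ρ α Q₀ x (j + i)
    have h3 := norm_tdUpdate_le M n hc hρ x (j + i) (Q (j + i))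
    have h4 : ‖α • tdUpdate M n c ρ x (j + i) (Q (j + i))‖ ≤ α * B * (2 * (‖Q j‖ + 1)) := by
      rw [norm_smul, Real.norm_of_nonneg hα, mul_assoc]
      exact mul_le_mul_of_nonneg_left (h3.trans (mul_le_mul_of_nonneg_left h1 hB)) hα
    rw [h2, add_sub_right_comm]
    refine (norm_add_le _ _).trans ?_
    push_cast
    linarith

/-- The matrix `M̄` with expected update `Q ↦ (M̄ - 1) (Q - Qs)`. -/
def meanMatrix (M : FiniteMDP S A) (πb : Policy S A) (n : ℕ) (c ρ : S × A → ℝ) (κ : S → ℝ) :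
    Matrix (S × A) (S × A) ℝ :=
  1 - diagonal (fun y => κ y.1 * πb.prob y.1 y.2) *
    (1 - multistep n (weightedKernel M πb c) (weightedKernel M πb ρ))

theorem mul_meanTdSum_eq (M : FiniteMDP S A) (πb : Policy S A) (n : ℕ) (c : S × A → ℝ)
    {ρ Qs : S × A → ℝ} (h : bellmanOp M πb ρ Qs = Qs) (κ : S → ℝ) (Q : S × A → ℝ) :
    (fun y => κ y.1 * πb.prob y.1 y.2) * meanTdSum M πb n c ρ Q =
      meanMatrix M πb n c ρ κ *ᵥ (Q - Qs) - (Q - Qs) := by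
  rw [meanTdSum_eq M πb n c h, meanMatrix, sub_mulVec (1 : Matrix (S × A) (S × A) ℝ), one_mulVec,
    sub_sub_cancel_left, ← mulVec_mulVec, ← mulVec_neg, ← neg_mulVec, neg_sub]
  funext y
  rw [mulVec_diagonal, Pi.mul_apply]

section Contraction

variable {M : FiniteMDP S A} {πb : Policy S A} {n : ℕ} {c ρ : S × A → ℝ}

theorem multistep_weightedKernel_nonneg (hc : ∀ x, 0 ≤ c x) (hcρ : ∀ x, c x ≤ ρ x) (x y : S × A) :
    0 ≤ multistep n (weightedKernel M πb c) (weightedKernel M πb ρ) x y := by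
  refine multistep_nonneg (weightedKernel_nonneg M πb hc) (fun x y => ?_) n x y
  rw [weightedKernel_apply, weightedKernel_apply]
  exact mul_le_mul_of_nonneg_left (mul_le_mul_of_nonneg_left (hcρ y) M.discount_mem.1.le)
    (pairChain_nonneg M πb x y)

theorem sum_multistep_weightedKernel_le (hc : ∀ x, 0 ≤ c x)
    (hD : (⨆ s, diagD πb ρ s) < 1 / M.discount) (x : S × A) :
    ∑ y, multistep n (weightedKernel M πb c) (weightedKernel M πb ρ) x y ≤
      1 - geomFactor n (M.discount * ⨅ s, diagD πb c s) *
        (1 - M.discount * ⨆ s, diagD πb ρ s) := by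
  rw [geomFactor_eq_sum]
  exact sum_multistep_le (weightedKernel_nonneg M πb hc) (discount_mul_iInf_nonneg hc)
    (discount_mul_iSup_lt_one hD).le (le_sum_weightedKernel M πb c)
    (sum_weightedKernel_le M πb ρ) n x

theorem norm_meanTdSum_sub_le (hc : ∀ x, 0 ≤ c x) (hcρ : ∀ x, c x ≤ ρ x)
    (hD : (⨆ s, diagD πb ρ s) < 1 / M.discount) (hn : 1 ≤ n) {Qs : S × A → ℝ}
    (h : bellmanOp M πb ρ Qs = Qs) (Q Q' : S × A → ℝ) :
    ‖meanTdSum M πb n c ρ Q - meanTdSum M πb n c ρ Q'‖ ≤ 2 * ‖Q - Q'‖ := by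
  rw [meanTdSum_eq M πb n c h, meanTdSum_eq M πb n c h, ← mulVec_sub, sub_sub_sub_cancel_right,
    sub_mulVec, one_mulVec]
  have h1 := norm_mulVec_le_of_rowSum_le (q := 1) (multistep_weightedKernel_nonneg
    (M := M) (πb := πb) (n := n) hc hcρ) zero_le_one
    (fun x => (sum_multistep_weightedKernel_le hc hD x).trans
      (by linarith [contraction_factor_pos (n := n) hc hD hn])) (Q - Q')
  refine (norm_sub_le _ _).trans ?_
  linarith

theorem norm_meanTdSum_le (hc : ∀ x, 0 ≤ c x) (hcρ : ∀ x, c x ≤ ρ x)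
    (hD : (⨆ s, diagD πb ρ s) < 1 / M.discount) (hn : 1 ≤ n) {Qs : S × A → ℝ}
    (h : bellmanOp M πb ρ Qs = Qs) (Q : S × A → ℝ) : ‖meanTdSum M πb n c ρ Q‖ ≤ 2 * ‖Q - Qs‖ := by
  have h1 := norm_meanTdSum_sub_le hc hcρ hD hn h Q Qs
  rwa [meanTdSum_eq M πb n c h Qs, sub_self, mulVec_zero, sub_zero] at h1

variable {κ : S → ℝ}

/-- Row `x` is the convex combination of the identity and the multistep matrix with weight `κ(s)
πb(a | s)` on the latter. -/
theorem meanMatrix_nonneg (hc : ∀ x, 0 ≤ c x) (hcρ : ∀ x, c x ≤ ρ x)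
    (hκ : κ ∈ stdSimplex ℝ S) (x y : S × A) : 0 ≤ meanMatrix M πb n c ρ κ x y := by
  obtain ⟨h0, h1⟩ := stationary_pair_mem (πb := πb) hκ x
  have h2 := multistep_weightedKernel_nonneg (M := M) (πb := πb) (n := n) hc hcρ x y
  rw [meanMatrix, Matrix.sub_apply, diagonal_mul, Matrix.sub_apply, one_apply]
  have h3 := mul_nonneg h0 h2
  split_ifs <;> nlinarith

theorem sum_meanMatrix_le (hκ : κ ∈ stdSimplex ℝ S) (hc : ∀ x, 0 ≤ c x)
    (hD : (⨆ s, diagD πb ρ s) < 1 / M.discount) (hn : 1 ≤ n) (x : S × A) :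
    ∑ y, meanMatrix M πb n c ρ κ x y ≤ 1 - modulus M πb n c ρ κ := by
  have h1 := sum_multistep_weightedKernel_le (n := n) hc hD x
  have h2 : kappaMin πb κ ≤ κ x.1 * πb.prob x.1 x.2 :=
    ciInf_le (Set.finite_range fun x : S × A => κ x.1 * πb.prob x.1 x.2).bddBelow x
  have h3 := contraction_factor_pos (n := n) hc hD hn
  have h0 := (stationary_pair_mem (πb := πb) hκ x).1
  have h4 : ∑ y, meanMatrix M πb n c ρ κ x y = 1 - κ x.1 * πb.prob x.1 x.2 *
      (1 - ∑ y, multistep n (weightedKernel M πb c) (weightedKernel M πb ρ) x y) := by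
    simp [meanMatrix, diagonal_mul, Finset.sum_sub_distrib, ← Finset.mul_sum, one_apply]
  rw [h4, modulus]
  have h5 := mul_le_mul_of_nonneg_left (sub_le_sub_left h1 1) h0
  have h6 := mul_le_mul_of_nonneg_right h2 h3.le
  rw [sub_sub_cancel] at h5
  linarith

end Contraction

end TD


/-! ### Choice of the exponent and the expected drift. -/

open Matrix

/-- Take `r + 1 = ⌈2 L⌉`: the first bound uses `2 log 2 > 1`, and the others use `L ≥ log 2`, which
gives `2 L > 1` and `4 L + 1 ≤ 11 L / 2`. -/
theorem exists_exponent {d ω : ℝ} (hω : 0 < ω) (hd : ω ≤ d) :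
    ∃ r : ℕ, 2 * d ≤ 2 ^ (r + 1) * ω ∧ (3 : ℝ) ≤ 2 * r + 1 ∧
      (2 * r + 1 : ℝ) ≤ 11 / 2 * Real.log (2 * d / ω) := by
  have hdω : 2 ≤ 2 * d / ω := by rw [le_div_iff₀ hω]; linarith
  have hL := Real.log_le_log two_pos hdω
  have h2 := Real.log_two_gt_d9
  set L := Real.log (2 * d / ω) with hLdef
  have hm : 1 < ⌈2 * L⌉₊ := Nat.lt_ceil.2 (by push_cast; linarith)
  have hm1 : 2 * L ≤ ⌈2 * L⌉₊ := Nat.le_ceil _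
  have hm2 : (⌈2 * L⌉₊ : ℝ) < 2 * L + 1 := Nat.ceil_lt_add_one (by linarith)
  obtain ⟨r, hr⟩ : ∃ r, ⌈2 * L⌉₊ = r + 1 := ⟨⌈2 * L⌉₊ - 1, by omega⟩
  rw [hr] at hm hm1 hm2
  push_cast at hm1 hm2
  refine ⟨r, ?_, ?_, by linarith⟩
  · rw [← div_le_iff₀ hω, ← Real.log_le_log_iff (by linarith) (by positivity), Real.log_pow,
      ← hLdef]
    push_cast
    nlinarith
  · have : (1 : ℝ) ≤ r := by exact_mod_cast (by omega : 1 ≤ r)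
    linarith

section TD

variable {S A : Type*} [Fintype S] [DecidableEq S] [Fintype A]

theorem modulus_pos [Nonempty S] [Nonempty A] {M : FiniteMDP S A} {πb : Policy S A} {n : ℕ}
    {c ρ : S × A → ℝ} (hc : ∀ x, 0 ≤ c x) (hD : (⨆ s, diagD πb ρ s) < 1 / M.discount)
    (hn : 1 ≤ n) {κ : S → ℝ} (hκ : ∀ s, 0 < κ s) (hπb : ∀ s a, 0 < πb.prob s a) :
    0 < modulus M πb n c ρ κ := by
  have h1 : 0 < kappaMin πb κ := by
    obtain ⟨x, hx⟩ := exists_eq_ciInf_of_finite (f := fun x : S × A => κ x.1 * πb.prob x.1 x.2)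
    rw [kappaMin, ← hx]
    exact mul_pos (hκ _) (hπb _ _)
  rw [modulus, mul_assoc]
  exact mul_pos h1 (contraction_factor_pos hc hD hn)

variable [DecidableEq A]

theorem modulus_le_one [Nonempty S] [Nonempty A] {M : FiniteMDP S A} {πb : Policy S A} {n : ℕ}
    {c ρ : S × A → ℝ} (hc : ∀ x, 0 ≤ c x) (hcρ : ∀ x, c x ≤ ρ x)
    (hD : (⨆ s, diagD πb ρ s) < 1 / M.discount) (hn : 1 ≤ n) {κ : S → ℝ}
    (hκ : κ ∈ stdSimplex ℝ S) : modulus M πb n c ρ κ ≤ 1 := by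
  obtain ⟨x⟩ : Nonempty (S × A) := inferInstance
  have h1 := sum_meanMatrix_le (n := n) hκ hc hD hn x
  have h2 := Finset.sum_nonneg fun y (_ : y ∈ Finset.univ) =>
    meanMatrix_nonneg (M := M) (πb := πb) (n := n) hc hcρ hκ x y
  linarith

/-- Drift of the expected Lyapunov function along the algorithm, once the chain has mixed. -/
theorem integral_lyapunov_succ_le {M : FiniteMDP S A} {πb : Policy S A} {n : ℕ} (hn : 1 ≤ n)
    {c ρ : S × A → ℝ} (hc : ∀ x, 0 ≤ c x) (hcρ : ∀ x, c x ≤ ρ x)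
    (hD : (⨆ s, diagD πb ρ s) < 1 / M.discount) {κ : S → ℝ} (hκ : κ ∈ stdSimplex ℝ S)
    {Qs : S × A → ℝ} (hQs : bellmanOp M πb ρ Qs = Qs)
    {V : (S × A → ℝ) → ℝ} {J : (S × A → ℝ) → S × A → ℝ} {K ω : ℝ}
    (hV : ∀ x, V x ≤ ‖x‖ ^ 2) (hV2 : ∀ x, ‖x‖ ^ 2 ≤ 2 * V x)
    (hsmooth : ∀ x y, V (x + y) ≤ V x + 2 * (J x ⬝ᵥ y) + K * V y)
    (hJ : ∀ x y, J x ⬝ᵥ y ≤ ‖x‖ * ‖y‖)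
    (hJlip : ∀ x y w, (J x - J y) ⬝ᵥ w ≤ K * ‖x - y‖ * ‖w‖)
    (hdrift : ∀ x, J x ⬝ᵥ (meanMatrix M πb n c ρ κ *ᵥ x - x) ≤ -(ω / 2) * V x)
    (hK : 3 ≤ K) {α : ℝ} (hα : 0 < α) {t : ℕ}
    (hmix : ∀ s, tvDist ((stateChain M πb ^ t) s) κ ≤ α)
    (hsmall : α * updateBound M n c ρ * (t + n + 1 : ℕ) ≤ 1 / 4)
    {Ω : Type*} [MeasurableSpace Ω] {μ : Measure Ω} [IsProbabilityMeasure μ] {X : ℕ → Ω → S × A}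
    (hX : IsMarkovChain (pairChain M πb) μ X) (Q₀ : S × A → ℝ) (j : ℕ) :
    ∫ w, V (tdIterate M n c ρ (fun _ => α) Q₀ (fun i => X i w) (j + (t + n + 1) + 1) - Qs) ∂μ ≤
      (1 - α * ω) * ∫ w, V (tdIterate M n c ρ (fun _ => α) Q₀ (fun i => X i w)
        (j + (t + n + 1)) - Qs) ∂μ +
      46 * (α * (updateBound M n c ρ * (α * updateBound M n c ρ * (t + n + 1 : ℕ))) * K) *
        (4 * ∫ w, V (tdIterate M n c ρ (fun _ => α) Q₀ (fun i => X i w)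
          (j + (t + n + 1)) - Qs) ∂μ + 2 * (‖Qs‖ + 1) ^ 2) := by
  have hρ : ∀ x, 0 ≤ ρ x := fun x => (hc x).trans (hcρ x)
  have hB := one_le_updateBound M hn hc hρ
  set B := updateBound M n c ρ with hBdef
  set ε := α * B * (t + n + 1 : ℕ) with hεdef
  set c₀ := ‖Qs‖ + 1 with hc₀
  have hc₀0 : 0 < c₀ := by positivity
  have hτ2 : (2 : ℝ) ≤ (t + n + 1 : ℕ) := by exact_mod_cast (by omega : 2 ≤ t + n + 1)
  have hαε : 2 * (α * B) ≤ ε := by rw [hεdef]; nlinarith [mul_pos hα (one_pos.trans_le hB)]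
  have hε : 0 ≤ ε := le_trans (by positivity) hαε
  set Q : ℕ → (ℕ → S × A) → S × A → ℝ := fun k h => tdIterate M n c ρ (fun _ => α) Q₀ h k with hQ
  have hQdep : ∀ k, DependsOn (Q k) (Set.Iic (k + n)) := dependsOn_tdIterate M n c ρ α Q₀
  set k := j + (t + n + 1) with hk
  let N : (S × A → ℝ) → S × A → ℝ := fun q => (fun y => κ y.1 * πb.prob y.1 y.2) *
    meanTdSum M πb n c ρ q
  -- A common scale dominating both `‖Q_k - Qs‖` and `‖Q_k‖ + 1`.
  let r : (ℕ → S × A) → ℝ := fun h => ‖Q k h - Qs‖ + c₀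
  let noise : (ℕ → S × A) → ℝ := fun h =>
    J (Q j h - Qs) ⬝ᵥ (tdUpdate M n c ρ h k (Q j h) - N (Q j h))
  have hclose : ∀ h, ‖Q k h - Q j h‖ ≤ 4 * ε * r h := fun h => by
    have h1 := norm_tdIterate_sub_le M n hc hρ hα.le Q₀ h (by linarith) (hsmall.trans (by norm_num))
      j (t + n + 1) le_rfl
    change ‖Q k h - Q j h‖ ≤ 2 * (α * B) * (t + n + 1 : ℕ) * (‖Q j h‖ + 1) at h1
    have h2 : ‖Q j h‖ ≤ ‖Q k h‖ + ‖Q k h - Q j h‖ := by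
      have := norm_sub_norm_le (Q j h) (Q k h)
      rw [norm_sub_rev] at this; linarith
    have h3 : ‖Q k h‖ ≤ ‖Q k h - Qs‖ + ‖Qs‖ := by
      have := norm_sub_norm_le (Q k h) Qs; linarith
    have h4 : 2 * (α * B) * (t + n + 1 : ℕ) = 2 * ε := by rw [hεdef]; ring
    rw [h4] at h1
    have h5 : ‖Q j h‖ + 1 ≤ 2 * r h := by
      have : 2 * ε * (‖Q j h‖ + 1) ≤ 1 / 2 * (‖Q j h‖ + 1) := by gcongr; linarith
      simp only [r]; linarith
    nlinarith
  have hpath : ∀ h, V (Q (k + 1) h - Qs) ≤ (1 - α * ω) * V (Q k h - Qs) + 2 * α * noise h +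
      α * (B * ε) * (49 / 2 * K + 48) * r h ^ 2 := fun h => by
    have h0 : Q (k + 1) h - Qs = (Q k h - Qs) + α • tdUpdate M n c ρ h k (Q k h) := by
      simp only [hQ]; rw [tdIterate_succ]; abel
    have hNn := norm_stationary_pair_mul_le (πb := πb) hκ
    have hsub : (Q k h - Qs) - (Q j h - Qs) = Q k h - Q j h := by abel
    rw [h0]
    refine lyapunov_step_le hV hsmooth hJ hJlip (by linarith) hα.le hB hε hsmall hαε
      (d := N (Q k h)) ?_ ?_ ?_ ?_ ?_ ?_ ?_
    · simp only [N]; rw [mul_meanTdSum_eq M πb n c hQs]; exact hdrift _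
    · simp only [r]; linarith
    · rw [hsub]; exact hclose h
    · refine (norm_tdUpdate_le M n hc hρ h k _).trans
        (mul_le_mul_of_nonneg_left ?_ (by linarith))
      have := norm_sub_norm_le (Q k h) Qs
      simp only [r]; linarith
    · rw [hsub]; exact norm_tdUpdate_sub_le M n hc hρ h k _ _
    · exact (hNn _).trans (norm_meanTdSum_le hc hcρ hD hn hQs _)
    · rw [hsub]
      simp only [N]
      rw [← mul_sub]
      exact (hNn _).trans (norm_meanTdSum_sub_le hc hcρ hD hn hQs _ _)
  have hnoise : ∫ w, noise (fun i => X i w) ∂μ ≤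
      ∫ w, ‖Q j (fun i => X i w) - Qs‖ * (2 * α * (2 * ‖Q j (fun i => X i w) - Qs‖)) ∂μ := by
    -- The lag splits into `n` steps until `Q_j` is determined and `t + 1` steps of mixing.
    have hkm : k = j + n + (t + 1) := by omega
    have hJd : DependsOn (fun h => J (Q j h - Qs)) (Set.Iic (j + n)) := fun h h' hh => by
      simp only [hQdep j hh]
    have had : DependsOn (fun h => ‖Q j h - Qs‖) (Set.Iic (j + n)) := fun h h' hh => by
      simp only [hQdep j hh]
    have hbd : DependsOn (fun h => 2 * ‖Q j h - Qs‖) (Set.Iic (j + n)) := fun h h' hh => by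
      simp only [hQdep j hh]
    simp only [noise, N, hkm]
    exact integral_dotProduct_noise_le hX n c ρ hα.le hmix (j + n) hJd (hQdep j) had hbd
      (fun h => norm_nonneg _) (fun h v => hJ _ v)
      (fun h => norm_meanTdSum_le hc hcρ hD hn hQs _)
  have hd1 : DependsOn (fun h => V (Q (k + 1) h - Qs)) (Set.Iic (k + 1 + n)) :=
    fun h h' hh => by simp only [hQdep (k + 1) hh]
  have hd2 : DependsOn (fun h => V (Q k h - Qs)) (Set.Iic (k + n)) :=
    fun h h' hh => by simp only [hQdep k hh]
  have hd3 : DependsOn noise (Set.Iic (k + n)) := fun h h' hh => by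
    have h1 := hQdep j (fun i hi => hh i (Set.mem_Iic.2 (by have := Set.mem_Iic.1 hi; omega)))
    have h2 := dependsOn_tdUpdate M n c ρ k hh
    dsimp only at h2
    simp only [noise, h1, h2]
  have hd4 : DependsOn (fun h => r h ^ 2) (Set.Iic (k + n)) :=
    fun h h' hh => by simp only [r, hQdep k hh]
  have hd5 : DependsOn (fun h => ‖Q j h - Qs‖ * (2 * α * (2 * ‖Q j h - Qs‖))) (Set.Iic (j + n)) :=
    fun h h' hh => by simp only [hQdep j hh]
  have hi1 := hX.integrable hd1
  have hi2 := hX.integrable hd2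
  have hi3 := hX.integrable hd3
  have hi4 := hX.integrable hd4
  have hi5 := hX.integrable hd5
  have hI1 := integral_mono hi1 (((hi2.const_mul (1 - α * ω)).add (hi3.const_mul (2 * α))).add
    (hi4.const_mul (α * (B * ε) * (49 / 2 * K + 48)))) fun w => hpath fun i => X i w
  have hI2 := integral_mono hi5 (hi4.const_mul (8 * (B * ε))) fun w => by
    set h : ℕ → S × A := fun i => X i w
    have h1 : ‖Q j h - Qs‖ ≤ 2 * r h := by
      have h2 : ‖Q j h - Qs‖ ≤ ‖Q k h - Qs‖ + ‖Q k h - Q j h‖ := by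
        have := norm_sub_le (Q k h - Qs) (Q k h - Q j h)
        rwa [sub_sub_sub_cancel_left] at this
      have h3 := hclose h
      have h4 : 4 * ε * r h ≤ 1 * r h := by
        have : 0 ≤ r h := by positivity
        gcongr; linarith
      simp only [r] at *
      linarith
    have h2 : ‖Q j h - Qs‖ ^ 2 ≤ (2 * r h) ^ 2 := pow_le_pow_left₀ (norm_nonneg _) h1 2
    have h3 : 2 * α ≤ B * ε := by nlinarith
    calc ‖Q j h - Qs‖ * (2 * α * (2 * ‖Q j h - Qs‖)) = 2 * (2 * α) * ‖Q j h - Qs‖ ^ 2 := by ring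
      _ ≤ 2 * (B * ε) * (2 * r h) ^ 2 := by gcongr
      _ = 8 * (B * ε) * r h ^ 2 := by ring
  have hI3 := integral_mono hi4 ((hi2.const_mul 4).add (integrable_const (2 * c₀ ^ 2))) fun w => by
    have h1 := hV2 (Q k (fun i => X i w) - Qs)
    simp only [r, Pi.add_apply]
    nlinarith [sq_nonneg (‖Q k (fun i => X i w) - Qs‖ - c₀)]
  rw [integral_add' ((hi2.const_mul _).add (hi3.const_mul _)) (hi4.const_mul _),
    integral_add' (hi2.const_mul _) (hi3.const_mul _), integral_const_mul, integral_const_mul,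
    integral_const_mul] at hI1
  rw [integral_const_mul] at hI2
  rw [integral_add' (hi2.const_mul _) (integrable_const _), integral_const_mul, integral_const,
    probReal_univ, one_smul] at hI3
  have hr0 : 0 ≤ ∫ w, r (fun i => X i w) ^ 2 ∂μ := integral_nonneg fun w => sq_nonneg _
  have hαBε : 0 ≤ α * (B * ε) := by positivity
  have h1 := mul_le_mul_of_nonneg_left (hnoise.trans hI2) (by linarith : 0 ≤ 2 * α)
  -- The noise contributes `2 * 8` to `48`, and `64 ≤ 43 K / 2` because `K ≥ 3`.
  have h2 : α * (B * ε) * (49 / 2 * K + 64) * ∫ w, r (fun i => X i w) ^ 2 ∂μ ≤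
      46 * (α * (B * ε) * K) * ∫ w, r (fun i => X i w) ^ 2 ∂μ := by
    refine mul_le_mul_of_nonneg_right ?_ hr0
    nlinarith
  have h3 := mul_le_mul_of_nonneg_left hI3 (by positivity : 0 ≤ 46 * (α * (B * ε) * K))
  linarith

end TD

end OffPolicyTD

/-- Finite-sample bound for the generic `n`-step off-policy TD algorithm with constant stepsize.
The norm `‖·‖` on `S × A → ℝ` is the sup norm. -/
theorem mainTheorem2 {S A : Type*} [Fintype S] [DecidableEq S] [Nonempty S]
    [Fintype A] [DecidableEq A] [Nonempty A]
    (M : OffPolicyTD.FiniteMDP S A) (πb : OffPolicyTD.Policy S A)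
    (n : ℕ) (hn : 1 ≤ n)
    (c ρ : S × A → ℝ) (hc : ∀ x, 0 ≤ c x)
    (hπb : ∀ s a, 0 < πb.prob s a)
    (hirr : (OffPolicyTD.stateChain M πb).IsIrreducible)
    (haper : OffPolicyTD.IsAperiodic (OffPolicyTD.stateChain M πb))
    (hcρ : ∀ x, c x ≤ ρ x)
    (hD : (⨆ s, OffPolicyTD.diagD πb ρ s) < 1 / M.discount) :
    (∃! κ : S → ℝ, OffPolicyTD.IsStationary (OffPolicyTD.stateChain M πb) κ) ∧
    (∃! Qs : S × A → ℝ, OffPolicyTD.bellmanOp M πb ρ Qs = Qs) ∧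
    ∀ (κ : S → ℝ) (Qs : S × A → ℝ),
      OffPolicyTD.IsStationary (OffPolicyTD.stateChain M πb) κ →
      OffPolicyTD.bellmanOp M πb ρ Qs = Qs →
      ∀ {Ω : Type*} [MeasurableSpace Ω] (μ : Measure Ω) [IsProbabilityMeasure μ]
        (X : ℕ → Ω → S × A), OffPolicyTD.IsTrajectory M πb μ X →
      ∀ (Q₀ : S × A → ℝ) (α : ℝ), 0 < α →
        α * OffPolicyTD.lag M πb n κ α ≤
          (1 / 32832) * OffPolicyTD.modulus M πb n c ρ κ /
            OffPolicyTD.varianceFactor M πb n c ρ κ →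
      ∀ k : ℕ, OffPolicyTD.lag M πb n κ α ≤ k →
        ∫ w, ‖OffPolicyTD.tdIterate M n c ρ (fun _ => α) Q₀ (fun i => X i w) k - Qs‖ ^ 2 ∂μ ≤
          2 * (‖Q₀ - Qs‖ + ‖Q₀‖ + 1) ^ 2 *
              (1 - OffPolicyTD.modulus M πb n c ρ κ * α / 2) ^
                (k - OffPolicyTD.lag M πb n κ α) +
            912 * Real.exp 1 * (3 * ‖Qs‖ + 1) ^ 2 *
              (OffPolicyTD.varianceFactor M πb n c ρ κ / OffPolicyTD.modulus M πb n c ρ κ) *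
              (α * OffPolicyTD.lag M πb n κ α) := by
  classical
  have hρ : ∀ x, 0 ≤ ρ x := fun x => (hc x).trans (hcρ x)
  have hP := OffPolicyTD.stateChain_mem_rowStochastic M πb
  obtain ⟨N, hN⟩ := OffPolicyTD.exists_pow_pos_of_isIrreducible_of_isAperiodic hirr haper
  obtain ⟨κ₀, hκ₀⟩ := OffPolicyTD.exists_isStationary hP
  refine ⟨⟨κ₀, hκ₀, fun κ hκ => hκ.unique hP hN hκ₀⟩,
    OffPolicyTD.existsUnique_bellmanOp_fixedPoint M πb hρ hD, ?_⟩
  intro κ Qs hκ hQs Ω _ μ _ X hX Q₀ α hα hαle k hk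
  have hX := hX.isMarkovChain
  have hω := OffPolicyTD.modulus_pos (M := M) (n := n) hc hD hn (hκ.pos hN) hπb
  have hω1 := OffPolicyTD.modulus_le_one (M := M) (πb := πb) (n := n) hc hcρ hD hn hκ.1
  have hB := OffPolicyTD.one_le_updateBound M hn hc hρ
  have hmix := OffPolicyTD.tvDist_pow_mixingTime_le hP hN hκ hα
  rw [OffPolicyTD.lag] at hαle hk ⊢
  have hvf : OffPolicyTD.varianceFactor M πb n c ρ κ =
      Real.log (2 * Fintype.card (S × A) / OffPolicyTD.modulus M πb n c ρ κ) *
        OffPolicyTD.updateBound M n c ρ ^ 2 := by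
    rw [OffPolicyTD.varianceFactor, OffPolicyTD.updateBound, Fintype.card_prod]
    push_cast
    ring_nf
  rw [hvf] at hαle ⊢
  have hd : (1 : ℝ) ≤ Fintype.card (S × A) := by exact_mod_cast Fintype.card_pos
  obtain ⟨r, hr, hK3, hKL⟩ := OffPolicyTD.exists_exponent hω (hω1.trans hd)
  obtain ⟨V, J, hV, hV2, hsmooth, hJ, hJlip, hdrift⟩ := OffPolicyTD.exists_lyapunov
    (OffPolicyTD.meanMatrix_nonneg (M := M) (πb := πb) (n := n) hc hcρ hκ.1) hω hω1
    (OffPolicyTD.sum_meanMatrix_le hκ.1 hc hD hn) r hr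
  set ω := OffPolicyTD.modulus M πb n c ρ κ
  set B := OffPolicyTD.updateBound M n c ρ with hBdef
  set L := Real.log (2 * Fintype.card (S × A) / ω)
  set K : ℝ := 2 * r + 1
  set t := OffPolicyTD.mixingTime (OffPolicyTD.stateChain M πb) κ α
  set T : ℝ := ((t + n + 1 : ℕ) : ℝ) with hT
  have hT1 : 1 ≤ T := by rw [hT]; exact_mod_cast (by omega : 1 ≤ t + n + 1)
  have hL : 1 / 2 ≤ L := by linarith
  have hL0 : 0 < L := by linarith
  have hB0 : 0 < B := by linarith
  have hkey : α * T * (L * B ^ 2) ≤ 1 / 32832 * ω := by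
    rwa [le_div_iff₀ (by positivity)] at hαle
  have hεB : α * B * T * B ≤ 1 / 16416 := by
    have h1 : α * B * T * B * (1 / 2) ≤ α * B * T * B * L :=
      mul_le_mul_of_nonneg_left hL (by positivity)
    linarith
  have hε : α * B * T ≤ 1 / 16416 :=
    (le_mul_of_one_le_right (by positivity) hB).trans hεB
  have hα1 : α ≤ 1 := by
    have h1 : α ≤ α * (B * T) :=
      le_mul_of_one_le_right hα.le (one_le_mul_of_one_le_of_one_le hB hT1)
    linarith
  have hαω : α * ω ≤ 1 := mul_le_one₀ hα1 hω.le hω1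
  have hαω0 : 0 < α * ω := mul_pos hα hω
  let a : ℕ → ℝ := fun j => ∫ w, V (OffPolicyTD.tdIterate M n c ρ (fun _ => α) Q₀
    (fun i => X i w) (j + (t + n + 1)) - Qs) ∂μ
  set c₀ := ‖Qs‖ + 1 with hc₀
  have ha0 : ∀ j, 0 ≤ a j := fun j => integral_nonneg fun w => by
    have h1 := hV2 (OffPolicyTD.tdIterate M n c ρ (fun _ => α) Q₀
      (fun i => X i w) (j + (t + n + 1)) - Qs)
    have h2 := sq_nonneg ‖OffPolicyTD.tdIterate M n c ρ (fun _ => α) Q₀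
      (fun i => X i w) (j + (t + n + 1)) - Qs‖
    simp only [Pi.zero_apply]
    linarith
  set b : ℝ := 92 * (α * (B * (α * B * T)) * K) * c₀ ^ 2 with hb
  -- With this bound the feedback term `184 (…) a j` below uses up at most half of the contraction
  -- `α ω`.
  have hKsmall : B * (α * B * T) * K ≤ 11 / 2 * (1 / 32832 * ω) := by
    calc B * (α * B * T) * K ≤ B * (α * B * T) * (11 / 2 * L) :=
          mul_le_mul_of_nonneg_left hKL (by positivity)
      _ = 11 / 2 * (α * T * (L * B ^ 2)) := by ring
      _ ≤ _ := by linarith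
  have hrec : ∀ j, a (j + 1) ≤ (1 - ω * α / 2) * a j + b := fun j => by
    have h1 := OffPolicyTD.integral_lyapunov_succ_le hn hc hcρ hD hκ.1 hQs hV hV2 hsmooth hJ hJlip
      hdrift hK3 hα hmix (hε.trans (by norm_num)) hX Q₀ j
    rw [show j + (t + n + 1) + 1 = j + 1 + (t + n + 1) by ring] at h1
    change a (j + 1) ≤ (1 - α * ω) * a j + 46 * (α * (B * (α * B * T)) * K) *
      (4 * a j + 2 * c₀ ^ 2) at h1
    have h2 : 184 * (α * (B * (α * B * T)) * K) * a j ≤ α * ω / 2 * a j := by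
      refine mul_le_mul_of_nonneg_right ?_ (ha0 j)
      have := mul_le_mul_of_nonneg_left hKsmall hα.le
      linarith
    rw [hb]
    linarith
  have hb0 : 0 ≤ b := by positivity
  have hgeo := OffPolicyTD.le_of_geometric_recursion (by linarith) (by linarith) hb0 hrec
    (k - (t + n + 1))
  have hdep : ∀ i, DependsOn (fun h : ℕ → S × A => ‖OffPolicyTD.tdIterate M n c ρ (fun _ => α) Q₀
      h i - Qs‖ ^ 2) (Set.Iic (i + n)) := fun i h h' hh => by
    have h1 := OffPolicyTD.dependsOn_tdIterate M n c ρ α Q₀ i hh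
    dsimp only at h1 ⊢
    rw [h1]
  have hdepV : ∀ i, DependsOn (fun h : ℕ → S × A => V (OffPolicyTD.tdIterate M n c ρ (fun _ => α)
      Q₀ h i - Qs)) (Set.Iic (i + n)) := fun i h h' hh => by
    have h1 := OffPolicyTD.dependsOn_tdIterate M n c ρ α Q₀ i hh
    dsimp only at h1 ⊢
    rw [h1]
  -- During the first lag the iterate moves by at most `‖Q₀‖ + 1`, whatever the path.
  have hinit : a 0 ≤ (‖Q₀ - Qs‖ + ‖Q₀‖ + 1) ^ 2 := by
    have h1 := integral_mono (μ := μ) (hX.integrable (hdepV (0 + (t + n + 1))))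
      (integrable_const ((‖Q₀ - Qs‖ + ‖Q₀‖ + 1) ^ 2)) fun w => by
        refine (hV _).trans (pow_le_pow_left₀ (norm_nonneg _) ?_ 2)
        have h2 := OffPolicyTD.norm_tdIterate_sub_le M n hc hρ hα.le Q₀ (fun i => X i w)
          (N := t + n + 1) hB0.le (hε.trans (by norm_num)) 0 (t + n + 1) le_rfl
        rw [← hBdef, ← hT, OffPolicyTD.tdIterate] at h2
        have h3 := norm_sub_le_norm_sub_add_norm_sub (OffPolicyTD.tdIterate M n c ρ (fun _ => α)
          Q₀ (fun i => X i w) (0 + (t + n + 1))) Q₀ Qs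
        have h4 : 2 * (α * B) * T * (‖Q₀‖ + 1) ≤ 1 * (‖Q₀‖ + 1) :=
          mul_le_mul_of_nonneg_right (by linarith) (by positivity)
        linarith
    simpa [a] using h1
  have hfinal : ∫ w, ‖OffPolicyTD.tdIterate M n c ρ (fun _ => α) Q₀ (fun i => X i w) k - Qs‖ ^ 2 ∂μ
      ≤ 2 * a (k - (t + n + 1)) := by
    simp only [a]
    rw [Nat.sub_add_cancel hk, ← integral_const_mul]
    exact integral_mono (hX.integrable (hdep k)) ((hX.integrable (hdepV k)).const_mul 2)
      fun w => hV2 _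
  have hq : 0 ≤ (1 - ω * α / 2) ^ (k - (t + n + 1)) := pow_nonneg (by linarith) _
  have h1 := mul_le_mul_of_nonneg_left hinit hq
  -- The geometric series divides `b` by `ω α / 2`, giving `368`; with `K ≤ 11 L / 2` this becomes
  -- `2024`, below `912 e`.
  have h2 : 2 * (b / (1 - (1 - ω * α / 2))) ≤
      912 * Real.exp 1 * (3 * ‖Qs‖ + 1) ^ 2 * (L * B ^ 2 / ω) * (α * T) := by
    have hbe : 2 * (b / (1 - (1 - ω * α / 2))) =
        368 * (B * (α * B * T) / ω * K) * c₀ ^ 2 := by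
      rw [hb, sub_sub_cancel]; field_simp; ring
    have hce : c₀ ^ 2 ≤ (3 * ‖Qs‖ + 1) ^ 2 :=
      pow_le_pow_left₀ (by positivity) (by linarith [norm_nonneg Qs]) 2
    have he := Real.exp_one_gt_d9
    rw [hbe]
    calc 368 * (B * (α * B * T) / ω * K) * c₀ ^ 2
        ≤ 368 * (B * (α * B * T) / ω * (11 / 2 * L)) * (3 * ‖Qs‖ + 1) ^ 2 := by gcongr
      _ = 2024 * ((3 * ‖Qs‖ + 1) ^ 2 * (L * B ^ 2 / ω) * (α * T)) := by ring
      _ ≤ (912 * Real.exp 1) * ((3 * ‖Qs‖ + 1) ^ 2 * (L * B ^ 2 / ω) * (α * T)) :=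
          mul_le_mul_of_nonneg_right (by linarith) (by positivity)
      _ = _ := by ring
  linarith
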